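/- Consider the Cauchy problem $$u_t+f(k(x),u)_x=0\quad\text{on }\mathbb R\times[0,\infty),\qquad u(x,0)=u_0(x),$$ under the following assumptions. The initial datum $u_0\in L^\infty(\mathbb R)$ satisfies $u_0(x)\in[\underline u,\overline u]$ for a.e. $x$. The coefficient $k:\mathbb R\to\mathbb R$ has bounded variation, $k(x)\in[\underline k,\overline k]$ for a.e. $x$, it is $C^1$ off a finite set, and its set of discontinuities $D=\{x_1,\dots,x_M\}$ is finite; $k_m^\pm$ denote the one-sided limits of $k$ at $x_m$. For every $\kappa\in[\underline k,\overline k]$ we have $f(\kappa,\cdot)\in C^3[\underline u,\overline u]$, and for every $v\in\mathbb R$ we have $f(\cdot,v)\in C^2[\underline k,\overline k]$ with $\partial^2_{\kappa\kappa}f\equiv 0$ (only $f(\kappa,v)$ with $v\in[\underline u,\overline u]$ enters the scheme; for other $v$ this is any extension of the flux, which gives meaning to $f(\kappa,c)$ for all $c\in\mathbb R$). Fix $\lambda>0$ satisfying the CFL condition $\lambda|f_u(\kappa,v)|\le\frac12$ for all $(\kappa,v)\in[\underline k,\overline k]\times[\underline u,\overline u]$. Take mesh sizes $\Delta x>0$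 running through a sequence that tends to $0$, and put $\Delta t=\lambda\Delta x$, $t^n=n\Delta t$, $x_j=j\Delta x$ for $j\in\frac12\mathbb Z$. Put $k_j=\frac1{\Delta x}\int_{x_{j-1/2}}^{x_{j+1/2}}k\,dx$ for $j\in\frac12\mathbb Z$ and $u_j^0=\frac1{\Delta x}\int_{x_{j-1/2}}^{x_{j+1/2}}u_0\,dx$ for $j\in\mathbb Z$. On the staggered grid (at time level $n$ the indices are the $j\in\frac12\mathbb Z$ with $j+\frac n2\in\mathbb Z$) suppose that the numerical values are given by $$u^{n+1}_{j+\frac12}=\bar u^{n+1}_{j+\frac12}-a^{n+1}_{j+1}+a^{n+1}_j,\qquad n\ge0,$$ where: (i) $\bar u^{n+1}_{j+\frac12}=\frac12(u_j^n+u_{j+1}^n)-\lambda\big(f(k_{j+1},u_{j+1}^n)-f(k_j,u_j^n)\big)$ is the Lax–Friedrichs predictor; (ii) $|a_j^{n+1}|\le\mathcal K\,\Delta x^\alpha$ for all $n\ge 0$ and all $j$ with $j+\frac n2\in\mathbb Z$, with a constant $\mathcal K$ independent of $\Delta x$ and some $\alpha>\frac23$; (iii) the approximate solutions $u_\Delta$,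 defined by $u_\Delta=u_j^n$ on $[x_{j-\frac12},x_{j+\frac12})\times[t^n,t^{n+1})$ for $j+\frac n2\in\mathbb Z$, are bounded uniformly in $\Delta x$, with values in $[\underline u,\overline u]$; for all $X,T>0$ there is a constant $C$ independent of $\Delta x$ such that, with $N=\lfloor T/\Delta t\rfloor+1$ and $J=\lfloor X/\Delta x\rfloor+1$, $$\Delta x\sum_{n=0}^{N-1}\ \sum_{|j|\le J,\ j+\frac n2\in\mathbb Z}|u^n_{j+1}-u^n_j|^3\le C;$$ and $u_\Delta\to u$ a.e. on $\mathbb R\times[0,\infty)$ as $\Delta x\to0$. Then $u$ is an entropy solution: $u\in L^\infty(\mathbb R\times[0,\infty))$ and, for all $c\in\mathbb R$ and all nonnegative $\phi\in C_c^\infty(\mathbb R\times[0,\infty))$, $$\iint_{\mathbb R\times[0,\infty)}\big(|u-c|\phi_t+\operatorname{sgn}(u-c)(f(k(x),u)-f(k(x),c))\phi_x\big)\,dx\,dt+\int_{\mathbb R}|u_0-c|\,\phi(x,0)\,dx$$ $$+\iint_{(\mathbb R\setminus D)\times[0,\infty)}|f(k(x),c)_x|\,\phi\,dx\,dt+\sum_{m=1}^M\int_0^\infty|f(k_m^+,c)-f(k_m^-,c)|\,\phi(x_m,t)\,dt\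 \ge\ 0.$$ -/

import Mathlib

open MeasureTheory Filter Topology Set
open scoped ContDiff

/-- The average of `g` over the mesh cell of width `dx` centred at the point `i * dx / 2`.
Grid points are indexed by twice their spatial index: the integer `i = 2 * j` stands for
`x_j = j * dx`, where `j` is an integer or a half-integer. -/
noncomputable def cellAverage (g : ℝ → ℝ) (dx : ℝ) (i : ℤ) : ℝ :=
  (1 / dx) * ∫ x in (((i : ℝ) - 1) * dx / 2)..(((i : ℝ) + 1) * dx / 2), g x

/-- The staggered Lax–Friedrichs update at the point of index `i + 1`, computed from the values
`v` at the neighbouring points of index `i` and `i + 2`: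
`(v_j + v_{j+1}) / 2 - lam * (f (k_{j+1}, v_{j+1}) - f (k_j, v_j))` with `i = 2 * j`. -/
noncomputable def laxFriedrichsStep (f : ℝ → ℝ → ℝ) (k : ℝ → ℝ) (lam dx : ℝ) (v : ℤ → ℝ)
    (i : ℤ) : ℝ :=
  (1 / 2) * (v i + v (i + 2)) -
    lam * (f (cellAverage k dx (i + 2)) (v (i + 2)) - f (cellAverage k dx i) (v i))

/-- `U n i` is the numerical value at time level `n` at the point `i * dx / 2`; only the indices
`i` with the parity of `n` belong to the staggered grid at level `n`. The initial values are the
cell averages of `u0`, and each step is a Lax–Friedrichs predictor followed by the correction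
`- a^{n+1}_{j+1} + a^{n+1}_j`. -/
def IsPredictorCorrector (f : ℝ → ℝ → ℝ) (k u0 : ℝ → ℝ) (lam dx : ℝ)
    (U a : ℕ → ℤ → ℝ) : Prop :=
  (∀ i : ℤ, Even i → U 0 i = cellAverage u0 dx i) ∧
  ∀ (n : ℕ) (i : ℤ), Even (i + (n : ℤ)) →
    U (n + 1) (i + 1) = laxFriedrichsStep f k lam dx (U n) i - a (n + 1) (i + 2) + a (n + 1) i

/-- The piecewise constant function with the value `U n i` on
`[(i - 1) * dx / 2, (i + 1) * dx / 2) × [n * dt, (n + 1) * dt)`, for `i` of the parity of `n`. -/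
noncomputable def approxSolution (dx dt : ℝ) (U : ℕ → ℤ → ℝ) (x t : ℝ) : ℝ :=
  if Even ⌊t / dt⌋₊ then U ⌊t / dt⌋₊ (2 * ⌊x / dx + 1 / 2⌋)
  else U ⌊t / dt⌋₊ (2 * ⌊x / dx⌋ + 1)

/-- `dx * ∑_{n < N} ∑_{|j| ≤ J, j + n/2 ∈ ℤ} |u^n_{j+1} - u^n_j| ^ 3` with
`N = ⌊T / dt⌋ + 1` and `J = ⌊X / dx⌋ + 1` (here `i = 2 * j`). -/
noncomputable def cubicSum (dx dt : ℝ) (U : ℕ → ℤ → ℝ) (X T : ℝ) : ℝ :=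
  dx * ∑ n ∈ Finset.range (⌊T / dt⌋₊ + 1),
    ∑ i ∈ (Finset.Icc (-(2 * (⌊X / dx⌋ + 1))) (2 * (⌊X / dx⌋ + 1))).filter
      (fun i : ℤ => Even (i + (n : ℤ))), |U n (i + 2) - U n i| ^ 3

/-- Kruzhkov-type entropy solutions of `u_t + f(k(x), u)_x = 0`, `u(x, 0) = u0(x)` on
`ℝ × [0, ∞)`, where `D` is the finite set of discontinuities of `k`. The test functions are the
smooth compactly supported functions on the closed half plane `t ≥ 0` (restrictions of smooth
compactly supported functions on the plane), nonnegative there and not required to vanish at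
`t = 0`. -/
def IsEntropySolution (f : ℝ → ℝ → ℝ) (k : ℝ → ℝ) (D : Finset ℝ) (u0 : ℝ → ℝ)
    (u : ℝ → ℝ → ℝ) : Prop :=
  MemLp (fun p : ℝ × ℝ => u p.1 p.2) ⊤ (volume.restrict {p : ℝ × ℝ | 0 ≤ p.2}) ∧
  ∀ (c : ℝ) (φ : ℝ × ℝ → ℝ), ContDiff ℝ ∞ φ → HasCompactSupport φ →
    (∀ p : ℝ × ℝ, 0 ≤ p.2 → 0 ≤ φ p) →
    0 ≤ (∫ p in {p : ℝ × ℝ | 0 ≤ p.2},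
          (|u p.1 p.2 - c| * deriv (fun t => φ (p.1, t)) p.2 +
            Real.sign (u p.1 p.2 - c) * (f (k p.1) (u p.1 p.2) - f (k p.1) c) *
              deriv (fun x => φ (x, p.2)) p.1)) +
        (∫ x, |u0 x - c| * φ (x, 0)) +
        (∫ p in {p : ℝ × ℝ | p.1 ∉ D ∧ 0 ≤ p.2}, |deriv (fun x => f (k x) c) p.1| * φ p) +
        ∑ y ∈ D, ∫ t in Ici (0 : ℝ),
          |f (Function.rightLim k y) c - f (Function.leftLim k y) c| * φ (y, t)

/-! Under the CFL condition the Lax–Friedrichs step is monotone, so it satisfies a discrete Kruzhkov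
inequality for every parameter `s` in `[ul, uu]`, with source `lam * |f κ₂ s - f κ₁ s|`. Passing
from the predictor to the corrected value costs a subgradient of `|· - s|` times `a₁ - a₂`.
Summation by parts moves this difference onto the subgradient, but the subgradient is a sign
function, whose jumps are not controlled by those of the solution.

The inequality is therefore averaged over `s ∈ [c, c + ε]`: the averaged subgradient is Lipschitz
with constant `2 / ε` (`exists_regularized_entropy`). From `y ≤ τ + y ^ 3 / τ ^ 2` with `τ = dx ^
(1/3)`, the cubic estimate bounds the space-time integral of the jumps by a multiple of `dx ^
(1/3)`. The corrections thus contribute `O(dx ^ (α - 2/3) / ε)` plus `O(dx ^ α)`, which vanishes for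
`ε = dx ^ β` with `β = (α - 2/3) / 2` (`exists_corrector_bound`, `tendsto_corrector_rate`).

For the source, `∂²f/∂κ² = 0` gives `f κ v = A v + κ * B v`, so it is `|B s|` times the increment of
`k`. That increment is at most the increment of the cell averages of a distribution function `V` of
the variation of `k`, so the source is absorbed into the numerical flux as `- r * V`. Only a.e.
convergence of cell averages is then needed; in the limit, integrating `V * φ_x` by parts produces
the `|k'|` term and the jump terms (`setIntegral_variationFun_mul_deriv`).

Grid functions are treated throughout as piecewise constant functions on the half plane, so that
summation by parts is translation invariance of the integral and the limit is dominated convergence.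
-/

/-! ### Staggered grid functions on the half plane -/

/-- The index, of the parity of `n`, of the cell of the staggered grid at level `n` containing
`x`. -/
noncomputable def gridIndex (dx : ℝ) (n : ℕ) (x : ℝ) : ℤ :=
  if Even n then 2 * ⌊x / dx + 1 / 2⌋ else 2 * ⌊x / dx⌋ + 1

/-- The piecewise constant function on the half plane attached to a grid function. -/
noncomputable def gridFun (dx dt : ℝ) (g : ℕ → ℤ → ℝ) (p : ℝ × ℝ) : ℝ :=
  g ⌊p.2 / dt⌋₊ (gridIndex dx ⌊p.2 / dt⌋₊ p.1)

theorem approxSolution_eq_gridFun (dx dt : ℝ) (U : ℕ → ℤ → ℝ) (x t : ℝ) :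
    approxSolution dx dt U x t = gridFun dx dt U (x, t) := by
  unfold approxSolution gridFun gridIndex
  dsimp only
  split_ifs <;> rfl

theorem even_gridIndex_add (dx : ℝ) (n : ℕ) (x : ℝ) : Even (gridIndex dx n x + (n : ℤ)) := by
  unfold gridIndex
  split_ifs with h
  · exact (even_two_mul _).add (by exact_mod_cast h)
  · have : Odd (n : ℤ) := by exact_mod_cast Nat.not_even_iff_odd.mp h
    exact (odd_two_mul_add_one _).add_odd this

theorem gridIndex_le {dx : ℝ} (hdx : 0 < dx) (n : ℕ) (x : ℝ) :
    ((gridIndex dx n x : ℝ) - 1) * dx / 2 ≤ x := by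
  unfold gridIndex
  split_ifs with h
  · have h1 := Int.floor_le (x / dx + 1 / 2)
    have h2 : x / dx * dx = x := by field_simp
    push_cast
    nlinarith
  · have h1 := Int.floor_le (x / dx)
    have h2 : x / dx * dx = x := by field_simp
    push_cast
    nlinarith

theorem lt_gridIndex {dx : ℝ} (hdx : 0 < dx) (n : ℕ) (x : ℝ) :
    x < ((gridIndex dx n x : ℝ) + 1) * dx / 2 := by
  unfold gridIndex
  split_ifs with h
  · have h1 := Int.lt_floor_add_one (x / dx + 1 / 2)
    have h2 : x / dx * dx = x := by field_simp
    push_cast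
    nlinarith
  · have h1 := Int.lt_floor_add_one (x / dx)
    have h2 : x / dx * dx = x := by field_simp
    push_cast
    nlinarith

/-- Grids at consecutive levels are offset by half a cell, so a shift by `dx / 2` at level `n`
amounts to reading the index at level `n + 1`. With its mirror image below, this turns the stencil
`i, i + 1, i + 2` into translations of the point. -/
theorem gridIndex_add_half {dx : ℝ} (hdx : 0 < dx) (n : ℕ) (x : ℝ) :
    gridIndex dx n (x + dx / 2) = gridIndex dx (n + 1) x + 1 := by
  have e : (x + dx / 2) / dx = x / dx + 1 / 2 := by field_simp
  unfold gridIndex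
  rw [e, add_assoc, show (1 / 2 + 1 / 2 : ℝ) = 1 by norm_num, Int.floor_add_one]
  by_cases h : Even n
  · have : ¬ Even (n + 1) := by simpa [Nat.even_add_one] using h
    simp only [h, this, if_true, if_false]; ring
  · have : Even (n + 1) := by simpa [Nat.even_add_one] using h
    simp only [h, this, if_true, if_false]

theorem gridIndex_sub_half {dx : ℝ} (hdx : 0 < dx) (n : ℕ) (x : ℝ) :
    gridIndex dx n (x - dx / 2) = gridIndex dx (n + 1) x - 1 := by
  have e : (x - dx / 2) / dx = x / dx - 1 / 2 := by field_simp
  have e' : x / dx - 1 / 2 = x / dx + 1 / 2 - 1 := by ring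
  unfold gridIndex
  rw [e, sub_add_cancel, e', Int.floor_sub_one]
  by_cases h : Even n
  · have : ¬ Even (n + 1) := by simpa [Nat.even_add_one] using h
    simp only [h, this, if_true, if_false]; ring
  · have : Even (n + 1) := by simpa [Nat.even_add_one] using h
    simp only [h, this, if_true, if_false]; ring

theorem floor_add_div_self {dt t : ℝ} (hdt : 0 < dt) (ht : 0 ≤ t) :
    ⌊(t + dt) / dt⌋₊ = ⌊t / dt⌋₊ + 1 := by
  rw [add_div, div_self hdt.ne', Nat.floor_add_one (by positivity)]

theorem measurable_gridFun (dx dt : ℝ) (g : ℕ → ℤ → ℝ) : Measurable (gridFun dx dt g) := by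
  have h1 : Measurable fun p : ℝ × ℝ => ⌊p.2 / dt⌋₊ :=
    Nat.measurable_floor.comp (measurable_snd.div_const dt)
  have h2 : Measurable fun p : ℝ × ℝ => ⌊p.1 / dx + 1 / 2⌋ :=
    Int.measurable_floor.comp ((measurable_fst.div_const dx).add_const _)
  have h3 : Measurable fun p : ℝ × ℝ => ⌊p.1 / dx⌋ :=
    Int.measurable_floor.comp (measurable_fst.div_const dx)
  -- The point enters only through three floors, hence through a countable discrete space on which
  -- every function is measurable.
  let G : ℕ × ℤ × ℤ → ℝ := fun z =>
    g z.1 (if Even z.1 then 2 * z.2.1 else 2 * z.2.2 + 1)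
  have hG : Measurable G := measurable_of_countable G
  exact hG.comp (h1.prodMk (h2.prodMk h3))

/-- A bound on the grid points of the right parity bounds the piecewise constant function. -/
theorem gridFun_forall {dx dt : ℝ} {g : ℕ → ℤ → ℝ} {S : Set ℝ}
    (h : ∀ (n : ℕ) (i : ℤ), Even (i + (n : ℤ)) → g n i ∈ S) (p : ℝ × ℝ) :
    gridFun dx dt g p ∈ S :=
  h _ _ (even_gridIndex_add _ _ _)

/-! ### Cell averages -/

theorem cellAverage_eq_setAverage {g : ℝ → ℝ} {dx : ℝ} (hdx : 0 < dx) (i : ℤ) :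
    cellAverage g dx i = ⨍ x in Metric.closedBall ((i : ℝ) * dx / 2) (dx / 2), g x := by
  have e1 : ((i : ℝ) - 1) * dx / 2 = (i : ℝ) * dx / 2 - dx / 2 := by ring
  have e2 : ((i : ℝ) + 1) * dx / 2 = (i : ℝ) * dx / 2 + dx / 2 := by ring
  rw [setAverage_eq, Real.closedBall_eq_Icc, integral_Icc_eq_integral_Ioc, cellAverage,
    intervalIntegral.integral_of_le (by nlinarith), e1, e2, Real.volume_real_Icc]
  have e3 : max ((i : ℝ) * dx / 2 + dx / 2 - ((i : ℝ) * dx / 2 - dx / 2)) 0 = dx := by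
    rw [max_eq_left] <;> linarith
  rw [e3, smul_eq_mul, one_div]

/-- Lebesgue differentiation along the cells of the staggered grids. -/
theorem ae_tendsto_cellAverage {g : ℝ → ℝ} (hg : LocallyIntegrable g volume) {dx : ℕ → ℝ}
    (hpos : ∀ m, 0 < dx m) (hdx : Tendsto dx atTop (𝓝 0)) :
    ∀ᵐ x : ℝ, ∀ n : ℕ → ℕ,
      Tendsto (fun m => cellAverage g (dx m) (gridIndex (dx m) (n m) x)) atTop (𝓝 (g x)) := by
  -- The cells need only contain `x` and shrink, not be centred at it. One null set therefore serves
  -- every choice of levels, and a level depending on time and mesh can be inserted later.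
  filter_upwards [IsUnifLocDoublingMeasure.ae_tendsto_average volume hg 1] with x hx n
  have h := hx (l := atTop)
    (fun m : ℕ => (gridIndex (dx m) (n m) x : ℝ) * dx m / 2) (fun m => dx m / 2) ?_ ?_
  · exact h.congr fun m => (cellAverage_eq_setAverage (hpos m) _).symm
  · rw [tendsto_nhdsWithin_iff]
    refine ⟨by simpa using hdx.div_const 2, Eventually.of_forall fun m => ?_⟩
    exact half_pos (hpos m)
  · refine Eventually.of_forall fun m => ?_
    rw [Real.closedBall_eq_Icc]
    have h1 := gridIndex_le (hpos m) (n m) x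
    have h2 := lt_gridIndex (hpos m) (n m) x
    constructor <;> linarith

theorem cellAverage_mono_on {g₁ g₂ : ℝ → ℝ} {dx : ℝ} (hdx : 0 < dx)
    (h₁ : LocallyIntegrable g₁ volume) (h₂ : LocallyIntegrable g₂ volume) {i : ℤ}
    (h : ∀ᵐ x, x ∈ Icc (((i : ℝ) - 1) * dx / 2) (((i : ℝ) + 1) * dx / 2) → g₁ x ≤ g₂ x) :
    cellAverage g₁ dx i ≤ cellAverage g₂ dx i := by
  unfold cellAverage
  refine mul_le_mul_of_nonneg_left ?_ (by positivity)
  refine intervalIntegral.integral_mono_ae_restrict (by nlinarith)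
    (h₁.integrableOn_isCompact isCompact_uIcc).intervalIntegrable
    (h₂.integrableOn_isCompact isCompact_uIcc).intervalIntegrable ?_
  exact (ae_restrict_iff' measurableSet_Icc).2 h

theorem cellAverage_const {dx : ℝ} (hdx : 0 < dx) (c : ℝ) (i : ℤ) :
    cellAverage (fun _ => c) dx i = c := by
  unfold cellAverage
  rw [intervalIntegral.integral_const, smul_eq_mul]
  field_simp
  ring

theorem cellAverage_mem_Icc {g : ℝ → ℝ} {dx a b : ℝ} (hdx : 0 < dx)
    (hg : LocallyIntegrable g volume) (h : ∀ᵐ x, g x ∈ Icc a b) (i : ℤ) :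
    cellAverage g dx i ∈ Icc a b := by
  constructor
  · rw [← cellAverage_const hdx a i]
    exact cellAverage_mono_on hdx (locallyIntegrable_const a) hg (h.mono fun x hx _ => hx.1)
  · rw [← cellAverage_const hdx b i]
    exact cellAverage_mono_on hdx hg (locallyIntegrable_const b) (h.mono fun x hx _ => hx.2)

theorem locallyIntegrable_of_ae_mem_Icc {g : ℝ → ℝ} {a b : ℝ}
    (hg : AEStronglyMeasurable g volume) (h : ∀ᵐ x, g x ∈ Icc a b) :
    LocallyIntegrable g volume := by
  refine (locallyIntegrable_const (max |a| |b|)).mono hg ?_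
  filter_upwards [h] with x hx
  rw [Real.norm_eq_abs, Real.norm_eq_abs]
  exact (abs_le_max_abs_abs hx.1 hx.2).trans (le_abs_self _)

/-- Differences of adjacent cell averages are integrals of differences. -/
theorem cellAverage_add_two {g : ℝ → ℝ} {dx : ℝ} (i : ℤ) :
    cellAverage g dx (i + 2) = cellAverage (fun x => g (x + dx)) dx i := by
  unfold cellAverage
  rw [intervalIntegral.integral_comp_add_right (fun x => g x)]
  push_cast
  congr 2 <;> ring

theorem cellAverage_sub {g₁ g₂ : ℝ → ℝ} {dx : ℝ}
    (h₁ : LocallyIntegrable g₁ volume) (h₂ : LocallyIntegrable g₂ volume) (i : ℤ) :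
    cellAverage (fun x => g₁ x - g₂ x) dx i = cellAverage g₁ dx i - cellAverage g₂ dx i := by
  unfold cellAverage
  rw [intervalIntegral.integral_sub
    (h₁.integrableOn_isCompact isCompact_uIcc).intervalIntegrable
    (h₂.integrableOn_isCompact isCompact_uIcc).intervalIntegrable, mul_sub]

/-- If the increments of `k` are controlled by those of `V` on the cells `i` and `i + 2`, so are
the increments of the cell averages. -/
theorem abs_cellAverage_add_two_sub_le {k V : ℝ → ℝ} {dx : ℝ} (hdx : 0 < dx)
    (hk : LocallyIntegrable k volume) (hV : LocallyIntegrable V volume) {i : ℤ}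
    (hk' : LocallyIntegrable (fun x => k (x + dx)) volume)
    (hV' : LocallyIntegrable (fun x => V (x + dx)) volume)
    (h : ∀ᵐ x, x ∈ Icc (((i : ℝ) - 1) * dx / 2) (((i : ℝ) + 1) * dx / 2) →
      |k (x + dx) - k x| ≤ V (x + dx) - V x) :
    |cellAverage k dx (i + 2) - cellAverage k dx i| ≤
      cellAverage V dx (i + 2) - cellAverage V dx i := by
  rw [cellAverage_add_two, cellAverage_add_two, ← cellAverage_sub hk' hk, ← cellAverage_sub hV' hV,
    abs_le']
  refine ⟨cellAverage_mono_on hdx (hk'.sub hk) (hV'.sub hV) (h.mono fun x hx hx' =>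
    (le_abs_self _).trans (hx hx')), ?_⟩
  have := cellAverage_mono_on hdx (hk.sub hk') (hV'.sub hV) (h.mono fun x hx hx' => by
    have := (neg_le_abs _).trans (hx hx')
    show k x - k (x + dx) ≤ V (x + dx) - V x
    linarith)
  have e := cellAverage_sub (dx := dx) hk hk' i
  have e' := cellAverage_sub (dx := dx) hk' hk i
  rw [e']
  calc _ = cellAverage (fun x => k x - k (x + dx)) dx i := by rw [e]; ring
    _ ≤ _ := this

/-! ### Summation by parts as translation of integrals -/

/-- Translation by `(s, r)` of integrals over half planes `b ≤ t`. -/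
theorem setIntegral_halfPlane_translate (g : ℝ × ℝ → ℝ) (s r b : ℝ) :
    ∫ p in {p : ℝ × ℝ | b ≤ p.2}, g (p + (s, r)) = ∫ p in {p : ℝ × ℝ | b + r ≤ p.2}, g p := by
  have hm : ∀ b : ℝ, MeasurableSet {p : ℝ × ℝ | b ≤ p.2} := fun b =>
    measurableSet_le measurable_const measurable_snd
  rw [← integral_indicator (hm _), ← integral_indicator (hm _)]
  conv_rhs => rw [← integral_add_right_eq_self _ ((s, r) : ℝ × ℝ)]
  congr 1
  ext p
  simp only [indicator, mem_ofPred_eq, Prod.snd_add, add_le_add_iff_right]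

theorem integrable_bdd_mul_of_compactSupport {g φ : ℝ × ℝ → ℝ} {M : ℝ} (hg : Measurable g)
    (hM : ∀ p, |g p| ≤ M) (hφ : Continuous φ) (hφc : HasCompactSupport φ) :
    Integrable (fun p => g p * φ p) volume :=
  (hφ.integrable_of_hasCompactSupport hφc).bdd_mul hg.aestronglyMeasurable
    (Eventually.of_forall hM)

theorem hasCompactSupport_comp_add_right {φ : ℝ × ℝ → ℝ} (hφc : HasCompactSupport φ)
    (v : ℝ × ℝ) : HasCompactSupport fun p => φ (p + v) :=
  hφc.comp_homeomorph (Homeomorph.addRight v)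

/-- The time difference of a test function, averaged over the stencil of the scheme. -/
noncomputable def timeQuotient (dx dt : ℝ) (φ : ℝ × ℝ → ℝ) (p : ℝ × ℝ) : ℝ :=
  (1 / 2 * (φ (p + (dx / 2, dt)) + φ (p + (-(dx / 2), dt))) - φ p) / dt

/-- The space difference of a test function over the stencil of the scheme. -/
noncomputable def spaceQuotient (dx dt : ℝ) (φ : ℝ × ℝ → ℝ) (p : ℝ × ℝ) : ℝ :=
  (φ (p + (dx / 2, dt)) - φ (p + (-(dx / 2), dt))) / dx

/-- The scheme in weak form: summation by parts as a translation of integrals. -/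
theorem weak_inequality_of_step {dx lam : ℝ} (hdx : 0 < dx) (hlam : 0 < lam)
    {η q e φ : ℝ × ℝ → ℝ} {M : ℝ}
    (hη : Measurable η) (hq : Measurable q) (he : Measurable e)
    (hηM : ∀ p, |η p| ≤ M) (hqM : ∀ p, |q p| ≤ M) (heM : ∀ p, |e p| ≤ M)
    (hφ : Continuous φ) (hφc : HasCompactSupport φ) (hφ0 : ∀ p : ℝ × ℝ, 0 ≤ p.2 → 0 ≤ φ p)
    (hstep : ∀ p : ℝ × ℝ, 0 ≤ p.2 → φ (p + (0, lam * dx)) ≠ 0 →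
      η (p + (0, lam * dx)) ≤ 1 / 2 * (η (p + (-(dx / 2), 0)) + η (p + (dx / 2, 0))) -
        lam * (q (p + (dx / 2, 0)) - q (p + (-(dx / 2), 0))) + e p) :
    0 ≤ (∫ p in {p : ℝ × ℝ | 0 ≤ p.2}, η p * timeQuotient dx (lam * dx) φ p) +
      (1 / (lam * dx)) * (∫ p in {p : ℝ × ℝ | 0 ≤ p.2 ∧ p.2 < lam * dx}, η p * φ p) +
      (∫ p in {p : ℝ × ℝ | 0 ≤ p.2}, q p * spaceQuotient dx (lam * dx) φ p) +
      (1 / (lam * dx)) * ∫ p in {p : ℝ × ℝ | 0 ≤ p.2}, e p * φ (p + (0, lam * dx)) := by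
  set dt := lam * dx with hdt
  have hdt0 : 0 < dt := mul_pos hlam hdx
  set S : Set (ℝ × ℝ) := {p | 0 ≤ p.2} with hS
  have hSm : MeasurableSet S := measurableSet_le measurable_const measurable_snd
  have sh : ∀ (v : ℝ × ℝ), Continuous fun p => φ (p + v) := fun v =>
    hφ.comp (continuous_id.add continuous_const)
  have hI : ∀ (g : ℝ × ℝ → ℝ) (v w : ℝ × ℝ), Measurable g → (∀ p, |g p| ≤ M) →
      Integrable (fun p => g (p + v) * φ (p + w)) volume := fun g v w hg hM =>
    integrable_bdd_mul_of_compactSupport (hg.comp (measurable_add_const v)) (fun p => hM _)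
      (sh w) (hasCompactSupport_comp_add_right hφc w)
  -- Horizontal translations preserve the half plane, so no boundary term arises when a space shift
  -- passes from `g` to `φ`.
  have hT : ∀ (g : ℝ × ℝ → ℝ) (s : ℝ), ∫ p in S, g (p + (s, 0)) * φ (p + (0, dt)) =
      ∫ p in S, g p * φ (p + (-s, dt)) := fun g s => by
    have := setIntegral_halfPlane_translate (fun p => g p * φ (p + (-s, dt))) s 0 0
    rw [add_zero] at this
    rw [← this]
    refine integral_congr_ae (Eventually.of_forall fun p => ?_)
    have e : p + (s, 0) + (-s, dt) = p + (0, dt) := by ext <;> simp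
    dsimp only
    rw [e]
  -- Where the shifted `φ` vanishes both integrands are zero, so the step inequality is needed only
  -- on the support. This matters because the variation of `k` is controlled only on a bounded
  -- interval.
  have h0 : ∫ p in S, η (p + (0, dt)) * φ (p + (0, dt)) ≤
      ∫ p in S, (1 / 2 * (η (p + (-(dx / 2), 0)) + η (p + (dx / 2, 0))) -
        lam * (q (p + (dx / 2, 0)) - q (p + (-(dx / 2), 0))) + e p) * φ (p + (0, dt)) := by
    refine setIntegral_mono_on (hI η _ _ hη hηM).integrableOn ?_ hSm ?_
    · have := ((((hI η (-(dx / 2), 0) (0, dt) hη hηM).add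
        (hI η (dx / 2, 0) (0, dt) hη hηM)).const_mul (1 / 2)).sub
        (((hI q (dx / 2, 0) (0, dt) hq hqM).sub
          (hI q (-(dx / 2), 0) (0, dt) hq hqM)).const_mul lam)).add
        (hI e 0 (0, dt) he heM)
      refine (this.congr (Eventually.of_forall fun p => ?_)).integrableOn
      simp only [Pi.add_apply, Pi.sub_apply, add_zero]
      ring
    · intro p hp
      by_cases h : φ (p + (0, dt)) = 0
      · simp [h]
      · refine mul_le_mul_of_nonneg_right (hstep p hp h) (hφ0 _ ?_)
        have : 0 ≤ p.2 := hp
        simp only [Prod.snd_add]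
        linarith
  -- The translation in time does not preserve the half plane: it loses the strip `0 ≤ t < dt`,
  -- which will carry the initial datum.
  have h1 : ∫ p in S, η (p + (0, dt)) * φ (p + (0, dt)) =
      (∫ p in S, η p * φ p) - ∫ p in {p : ℝ × ℝ | 0 ≤ p.2 ∧ p.2 < dt}, η p * φ p := by
    rw [setIntegral_halfPlane_translate (fun p => η p * φ p) 0 dt 0, zero_add]
    have hd : S = {p : ℝ × ℝ | 0 ≤ p.2 ∧ p.2 < dt} ∪ {p : ℝ × ℝ | dt ≤ p.2} := by
      ext p
      simp only [hS, mem_ofPred_eq, mem_union]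
      constructor
      · intro h
        by_cases h' : p.2 < dt
        · exact Or.inl ⟨h, h'⟩
        · exact Or.inr (not_lt.mp h')
      · rintro (h | h)
        · exact h.1
        · exact hdt0.le.trans h
    have hi : Integrable (fun p => η p * φ p) volume := by
      simpa using hI η 0 0 hη hηM
    rw [hd, setIntegral_union ?_ (measurableSet_le measurable_const measurable_snd)
      hi.integrableOn hi.integrableOn]
    · ring
    · rw [Set.disjoint_left]
      rintro p ⟨_, h⟩ h'
      exact absurd h (not_lt.mpr h')
  have h2 : ∫ p in S, (1 / 2 * (η (p + (-(dx / 2), 0)) + η (p + (dx / 2, 0))) -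
        lam * (q (p + (dx / 2, 0)) - q (p + (-(dx / 2), 0))) + e p) * φ (p + (0, dt)) =
      1 / 2 * ((∫ p in S, η p * φ (p + (dx / 2, dt))) + ∫ p in S, η p * φ (p + (-(dx / 2), dt))) -
      lam * ((∫ p in S, q p * φ (p + (-(dx / 2), dt))) - ∫ p in S, q p * φ (p + (dx / 2, dt))) +
      ∫ p in S, e p * φ (p + (0, dt)) := by
    have t1 := hT η (-(dx / 2))
    have t2 := hT η (dx / 2)
    have t3 := hT q (-(dx / 2))
    have t4 := hT q (dx / 2)
    rw [neg_neg] at t1 t3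
    rw [← t1, ← t2, ← t3, ← t4]
    have i1 := (hI η (-(dx / 2), 0) (0, dt) hη hηM).integrableOn (s := S)
    have i2 := (hI η (dx / 2, 0) (0, dt) hη hηM).integrableOn (s := S)
    have i3 := (hI q (dx / 2, 0) (0, dt) hq hqM).integrableOn (s := S)
    have i4 := (hI q (-(dx / 2), 0) (0, dt) hq hqM).integrableOn (s := S)
    have i5 : IntegrableOn (fun p => e p * φ (p + (0, dt))) S := by
      simpa using (hI e 0 (0, dt) he heM).integrableOn (s := S)
    have k1 : IntegrableOn (fun p => 1 / 2 * (η (p + (-(dx / 2), 0)) * φ (p + (0, dt)) +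
      η (p + (dx / 2, 0)) * φ (p + (0, dt)))) S := (i1.add i2).const_mul _
    have k2 : IntegrableOn (fun p => lam * (q (p + (dx / 2, 0)) * φ (p + (0, dt)) -
      q (p + (-(dx / 2), 0)) * φ (p + (0, dt)))) S := (i3.sub i4).const_mul _
    have k3 : IntegrableOn (fun p => 1 / 2 * (η (p + (-(dx / 2), 0)) * φ (p + (0, dt)) +
      η (p + (dx / 2, 0)) * φ (p + (0, dt))) - lam * (q (p + (dx / 2, 0)) * φ (p + (0, dt)) -
      q (p + (-(dx / 2), 0)) * φ (p + (0, dt)))) S := k1.sub k2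
    rw [← integral_add i1 i2, ← integral_sub i3 i4, ← integral_const_mul, ← integral_const_mul,
      ← integral_sub k1 k2, ← integral_add k3 i5]
    refine integral_congr_ae (Eventually.of_forall fun p => ?_)
    dsimp only [Pi.sub_apply, Pi.add_apply]
    ring
  have j : ∀ (g : ℝ × ℝ → ℝ) (w : ℝ × ℝ), Measurable g → (∀ p, |g p| ≤ M) →
      IntegrableOn (fun p => g p * φ (p + w)) S := fun g w hg hM => by
    simpa using (hI g 0 w hg hM).integrableOn (s := S)
  have h3 : ∫ p in S, η p * timeQuotient dx dt φ p =
      (1 / dt) * (1 / 2 * ((∫ p in S, η p * φ (p + (dx / 2, dt))) +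
        ∫ p in S, η p * φ (p + (-(dx / 2), dt))) - ∫ p in S, η p * φ p) := by
    have j0 : IntegrableOn (fun p => η p * φ p) S := by simpa using j η 0 hη hηM
    have j1 : IntegrableOn (fun p => 1 / 2 * (η p * φ (p + (dx / 2, dt)) +
      η p * φ (p + (-(dx / 2), dt)))) S := ((j η _ hη hηM).add (j η _ hη hηM)).const_mul _
    rw [← integral_add (j η _ hη hηM) (j η _ hη hηM), ← integral_const_mul, ← integral_sub
      j1 j0, ← integral_const_mul]
    refine integral_congr_ae (Eventually.of_forall fun p => ?_)
    dsimp only [Pi.sub_apply, Pi.add_apply, timeQuotient]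
    ring
  have h4 : ∫ p in S, q p * spaceQuotient dx dt φ p =
      (1 / dt) * (lam * ((∫ p in S, q p * φ (p + (dx / 2, dt))) -
        ∫ p in S, q p * φ (p + (-(dx / 2), dt)))) := by
    rw [← integral_sub (j q _ hq hqM) (j q _ hq hqM), ← integral_const_mul, ← integral_const_mul]
    refine integral_congr_ae (Eventually.of_forall fun p => ?_)
    dsimp only [spaceQuotient]
    rw [hdt]
    field_simp
  rw [h3, h4]
  rw [h1, h2] at h0
  have : 0 ≤ (1 / dt) * ((1 / 2 * ((∫ p in S, η p * φ (p + (dx / 2, dt))) +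
        ∫ p in S, η p * φ (p + (-(dx / 2), dt))) -
      lam * ((∫ p in S, q p * φ (p + (-(dx / 2), dt))) - ∫ p in S, q p * φ (p + (dx / 2, dt))) +
      ∫ p in S, e p * φ (p + (0, dt))) - ((∫ p in S, η p * φ p) -
        ∫ p in {p : ℝ × ℝ | 0 ≤ p.2 ∧ p.2 < dt}, η p * φ p)) :=
    mul_nonneg (by positivity) (sub_nonneg.mpr h0)
  calc (0 : ℝ) ≤ _ := this
    _ = _ := by ring

/-! ### Difference quotients of test functions and dominated convergence -/

theorem deriv_fst_eq_fderiv {φ : ℝ × ℝ → ℝ} (hφ : ContDiff ℝ ∞ φ) (p : ℝ × ℝ) :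
    deriv (fun x => φ (x, p.2)) p.1 = fderiv ℝ φ p (1, 0) := by
  have h : HasFDerivAt φ (fderiv ℝ φ p) p := (hφ.differentiable (by simp) p).hasFDerivAt
  have h2 : HasDerivAt (fun x : ℝ => (x, p.2)) ((1 : ℝ), (0 : ℝ)) p.1 :=
    (hasDerivAt_id p.1).prodMk (hasDerivAt_const p.1 p.2)
  exact (HasFDerivAt.comp_hasDerivAt (f := fun x : ℝ => (x, p.2)) p.1 h h2).deriv

theorem deriv_snd_eq_fderiv {φ : ℝ × ℝ → ℝ} (hφ : ContDiff ℝ ∞ φ) (p : ℝ × ℝ) :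
    deriv (fun t => φ (p.1, t)) p.2 = fderiv ℝ φ p (0, 1) := by
  have h : HasFDerivAt φ (fderiv ℝ φ p) p := (hφ.differentiable (by simp) p).hasFDerivAt
  have h2 : HasDerivAt (fun t : ℝ => (p.1, t)) ((0 : ℝ), (1 : ℝ)) p.2 :=
    (hasDerivAt_const p.2 p.1).prodMk (hasDerivAt_id p.2)
  exact (HasFDerivAt.comp_hasDerivAt (f := fun t : ℝ => (p.1, t)) p.2 h h2).deriv

theorem tendsto_diffQuotient {φ : ℝ × ℝ → ℝ} (hφ : ContDiff ℝ ∞ φ) {dx : ℕ → ℝ}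
    (hpos : ∀ m, 0 < dx m) (hdx : Tendsto dx atTop (𝓝 0)) (p : ℝ × ℝ) (s r : ℝ) :
    Tendsto (fun m => (φ (p + (s * dx m, r * dx m)) - φ p) / dx m) atTop
      (𝓝 (fderiv ℝ φ p (s, r))) := by
  have h : HasFDerivAt φ (fderiv ℝ φ p) p := (hφ.differentiable (by simp) p).hasFDerivAt
  have h1 := (h.hasLineDerivAt (s, r)).tendsto_slope_zero
  have h2 : Tendsto dx atTop (𝓝[≠] 0) :=
    tendsto_nhdsWithin_iff.2 ⟨hdx, Eventually.of_forall fun m => (hpos m).ne'⟩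
  refine (h1.comp h2).congr fun m => ?_
  simp only [Function.comp, Prod.smul_mk, smul_eq_mul]
  rw [mul_comm s, mul_comm r]
  field_simp

/-- The offsets `± dx / 2` cancel to first order in the mean, which leaves the time derivative. -/
theorem tendsto_timeQuotient {φ : ℝ × ℝ → ℝ} (hφ : ContDiff ℝ ∞ φ) {dx : ℕ → ℝ} {lam : ℝ}
    (hlam : 0 < lam) (hpos : ∀ m, 0 < dx m) (hdx : Tendsto dx atTop (𝓝 0)) (p : ℝ × ℝ) :
    Tendsto (fun m => timeQuotient (dx m) (lam * dx m) φ p) atTop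
      (𝓝 (deriv (fun t => φ (p.1, t)) p.2)) := by
  have h1 := tendsto_diffQuotient hφ hpos hdx p (1 / 2) lam
  have h2 := tendsto_diffQuotient hφ hpos hdx p (-(1 / 2)) lam
  have h3 := ((h1.add h2).const_mul (1 / 2)).div_const lam
  have e : 1 / 2 * (fderiv ℝ φ p (1 / 2, lam) + fderiv ℝ φ p (-(1 / 2), lam)) / lam =
      deriv (fun t => φ (p.1, t)) p.2 := by
    rw [deriv_snd_eq_fderiv hφ, ← map_add, Prod.mk_add_mk, add_neg_cancel,
      show ((0 : ℝ), lam + lam) = (2 * lam) • ((0 : ℝ), (1 : ℝ)) by ext <;> simp; ring, map_smul,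
      smul_eq_mul]
    field_simp
  rw [e] at h3
  refine h3.congr fun m => ?_
  have := (hpos m).ne'
  rw [timeQuotient, show 1 / 2 * dx m = dx m / 2 by ring,
    show -(1 / 2) * dx m = -(dx m / 2) by ring]
  field_simp
  ring

/-- The common time shift cancels to first order in the difference. -/
theorem tendsto_spaceQuotient {φ : ℝ × ℝ → ℝ} (hφ : ContDiff ℝ ∞ φ) {dx : ℕ → ℝ} {lam : ℝ}
    (hpos : ∀ m, 0 < dx m) (hdx : Tendsto dx atTop (𝓝 0)) (p : ℝ × ℝ) :
    Tendsto (fun m => spaceQuotient (dx m) (lam * dx m) φ p) atTop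
      (𝓝 (deriv (fun x => φ (x, p.2)) p.1)) := by
  have h1 := tendsto_diffQuotient hφ hpos hdx p (1 / 2) lam
  have h2 := tendsto_diffQuotient hφ hpos hdx p (-(1 / 2)) lam
  have h3 := h1.sub h2
  have e : fderiv ℝ φ p (1 / 2, lam) - fderiv ℝ φ p (-(1 / 2), lam) =
      deriv (fun x => φ (x, p.2)) p.1 := by
    rw [deriv_fst_eq_fderiv hφ, ← map_sub]
    congr 1
    ext <;> norm_num
  rw [e] at h3
  refine h3.congr fun m => ?_
  rw [spaceQuotient, show 1 / 2 * dx m = dx m / 2 by ring,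
    show -(1 / 2) * dx m = -(dx m / 2) by ring]
  ring

/-- A test function and its difference quotients are bounded and supported in a common box. -/
theorem exists_testFunction_bounds {φ : ℝ × ℝ → ℝ} (hφ : ContDiff ℝ ∞ φ)
    (hφc : HasCompactSupport φ) {lam : ℝ} (hlam : 0 < lam) :
    ∃ L R : ℝ, 0 < L ∧ 0 < R ∧ (∀ p, |φ p| ≤ L) ∧ (∀ p q, |φ p - φ q| ≤ L * ‖p - q‖) ∧
      (∀ p, φ p ≠ 0 → ‖p‖ ≤ R) ∧
      (∀ dx : ℝ, 0 < dx → dx ≤ 1 → ∀ p v, ‖v‖ ≤ (1 + lam) * dx → φ (p + v) ≠ 0 → ‖p‖ ≤ R) ∧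
      ∀ dx : ℝ, 0 < dx → dx ≤ 1 → ∀ p,
        |timeQuotient dx (lam * dx) φ p| ≤ (Metric.closedBall 0 R).indicator (fun _ => L) p ∧
        |spaceQuotient dx (lam * dx) φ p| ≤ (Metric.closedBall 0 R).indicator (fun _ => L) p := by
  obtain ⟨C, hC⟩ := hφ.lipschitzWith_of_hasCompactSupport hφc (by simp)
  obtain ⟨B, hB⟩ := hφc.exists_bound_of_continuous hφ.continuous
  obtain ⟨R₀, hR₀⟩ := hφc.isCompact.isBounded.subset_closedBall (0 : ℝ × ℝ)
  have hsupp : ∀ p, φ p ≠ 0 → ‖p‖ ≤ R₀ := fun p hp => by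
    simpa using hR₀ (subset_tsupport _ hp)
  have hlip : ∀ p q, |φ p - φ q| ≤ C * ‖p - q‖ := fun p q => by
    simpa [Real.norm_eq_abs] using hC.norm_sub_le p q
  have hC0 : (0 : ℝ) ≤ C := C.2
  have hB0 : 0 ≤ B := (norm_nonneg _).trans (hB 0)
  -- One constant for the sup bound, the Lipschitz bound and both quotients; the final `1` makes it
  -- positive.
  set L : ℝ := C + B + C * (1 + lam) / lam + 2 * C * (1 + lam) + 1 with hL
  have a1 : 0 ≤ C * (1 + lam) / lam := by positivity
  have a2 : 0 ≤ 2 * C * (1 + lam) := by positivity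
  -- Room for shifts of length at most `(1 + lam) * dx` with `dx ≤ 1`.
  set R : ℝ := |R₀| + 1 + lam with hR
  have hR₀' : R₀ ≤ R := by have := le_abs_self R₀; linarith
  have hsh : ∀ dx : ℝ, 0 < dx → dx ≤ 1 → ∀ p v, ‖v‖ ≤ (1 + lam) * dx → φ (p + v) ≠ 0 →
      ‖p‖ ≤ R := fun dx h0 h1 p v hv hp => by
    have h2 := hsupp _ hp
    have h3 : ‖p‖ ≤ ‖p + v‖ + ‖v‖ := by
      simpa using norm_sub_le (p + v) v
    have : (1 + lam) * dx ≤ 1 + lam := by nlinarith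
    have := le_abs_self R₀
    linarith
  have hv : ∀ dx : ℝ, 0 < dx → ∀ s : ℝ, |s| = 1 / 2 → ‖((s * dx, lam * dx) : ℝ × ℝ)‖ ≤
      (1 + lam) * dx := fun dx h0 s hs => by
    rw [Prod.norm_def]
    simp only [Real.norm_eq_abs, abs_mul, hs, abs_of_pos h0, abs_of_pos hlam]
    refine max_le ?_ ?_ <;> nlinarith
  refine ⟨L, R, by linarith, by positivity, fun p => (hB p).trans (by linarith), fun p q =>
    (hlip p q).trans (mul_le_mul_of_nonneg_right (by linarith) (norm_nonneg _)),
    fun p hp => (hsupp p hp).trans hR₀', hsh, fun dx h0 h1 p => ?_⟩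
  have v1 := hv dx h0 (1 / 2) (by norm_num)
  have v2 := hv dx h0 (-(1 / 2)) (by norm_num)
  rw [show 1 / 2 * dx = dx / 2 by ring] at v1
  rw [show -(1 / 2) * dx = -(dx / 2) by ring] at v2
  by_cases hp : p ∈ Metric.closedBall (0 : ℝ × ℝ) R
  · rw [indicator_of_mem hp]
    have b1 := hlip (p + (dx / 2, lam * dx)) p
    have b2 := hlip (p + (-(dx / 2), lam * dx)) p
    rw [add_sub_cancel_left] at b1 b2
    have b1' := b1.trans (mul_le_mul_of_nonneg_left v1 hC0)
    have b2' := b2.trans (mul_le_mul_of_nonneg_left v2 hC0)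
    obtain ⟨c1, c2⟩ := abs_le.1 b1'
    obtain ⟨d1, d2⟩ := abs_le.1 b2'
    constructor
    · rw [timeQuotient, abs_div, abs_of_pos (mul_pos hlam h0), div_le_iff₀ (mul_pos hlam h0)]
      have : C * ((1 + lam) * dx) ≤ L * (lam * dx) := by
        have e : C * ((1 + lam) * dx) = C * (1 + lam) / lam * (lam * dx) := by field_simp
        rw [e]
        exact mul_le_mul_of_nonneg_right (by linarith) (by positivity)
      rw [abs_le]
      constructor <;> linarith
    · rw [spaceQuotient, abs_div, abs_of_pos h0, div_le_iff₀ h0]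
      have : 2 * (C * ((1 + lam) * dx)) ≤ L * dx := by
        have e : 2 * (C * ((1 + lam) * dx)) = 2 * C * (1 + lam) * dx := by ring
        rw [e]
        exact mul_le_mul_of_nonneg_right (by linarith) h0.le
      rw [abs_le]
      constructor <;> linarith
  · rw [indicator_of_notMem hp]
    have hp' : ¬ ‖p‖ ≤ R := by simpa using hp
    have z0 : φ p = 0 := by
      by_contra h
      exact hp' ((hsupp p h).trans hR₀')
    have z1 : φ (p + (dx / 2, lam * dx)) = 0 := by
      by_contra h
      exact hp' (hsh dx h0 h1 p _ v1 h)
    have z2 : φ (p + (-(dx / 2), lam * dx)) = 0 := by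
      by_contra h
      exact hp' (hsh dx h0 h1 p _ v2 h)
    simp [timeQuotient, spaceQuotient, z0, z1, z2]

theorem integrable_indicator_closedBall (R L : ℝ) :
    Integrable ((Metric.closedBall (0 : ℝ × ℝ) R).indicator fun _ => L) volume :=
  (integrable_indicator_iff measurableSet_closedBall).2
    (integrableOn_const (measure_closedBall_lt_top.ne))

/-- Dominated convergence for a bounded a.e. convergent sequence tested against convergent
functions dominated by a multiple of the indicator of a ball. -/
theorem tendsto_setIntegral_mul {S : Set (ℝ × ℝ)} {G T : ℕ → ℝ × ℝ → ℝ} {G₀ T₀ : ℝ × ℝ → ℝ}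
    {M R L : ℝ} (hG : ∀ m, Measurable (G m)) (hT : ∀ m, Measurable (T m))
    (hGM : ∀ m p, |G m p| ≤ M)
    (hTM : ∀ᶠ m in atTop, ∀ p, |T m p| ≤ (Metric.closedBall 0 R).indicator (fun _ => L) p)
    (hGlim : ∀ᵐ p ∂(volume.restrict S), Tendsto (fun m => G m p) atTop (𝓝 (G₀ p)))
    (hTlim : ∀ p, Tendsto (fun m => T m p) atTop (𝓝 (T₀ p))) :
    Tendsto (fun m => ∫ p in S, G m p * T m p) atTop (𝓝 (∫ p in S, G₀ p * T₀ p)) := by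
  refine tendsto_integral_filter_of_dominated_convergence
    (fun p => M * (Metric.closedBall (0 : ℝ × ℝ) R).indicator (fun _ => L) p)
    (Eventually.of_forall fun m => ((hG m).mul (hT m)).aestronglyMeasurable) ?_
    (((integrable_indicator_closedBall R L).const_mul M).integrableOn) ?_
  · filter_upwards [hTM] with m hm
    refine Eventually.of_forall fun p => ?_
    rw [Real.norm_eq_abs, abs_mul]
    exact mul_le_mul (hGM m p) (hm p) (abs_nonneg _) ((abs_nonneg _).trans (hGM m p))
  · filter_upwards [hGlim] with p hp using hp.mul (hTlim p)

/-- The contribution of the first time layer converges to the initial trace. -/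
theorem tendsto_initialLayer {φ : ℝ × ℝ → ℝ} (hφ : ContDiff ℝ ∞ φ) (hφc : HasCompactSupport φ)
    {dt : ℕ → ℝ} (hpos : ∀ m, 0 < dt m) (hdt : Tendsto dt atTop (𝓝 0))
    {G : ℕ → ℝ × ℝ → ℝ} {g : ℕ → ℝ → ℝ} {g₀ : ℝ → ℝ} {M : ℝ} (hg : ∀ m, Measurable (g m))
    (hgM : ∀ m x, |g m x| ≤ M)
    (hG : ∀ m (p : ℝ × ℝ), 0 ≤ p.2 → p.2 < dt m → G m p = g m p.1)
    (hlim : ∀ᵐ x, Tendsto (fun m => g m x) atTop (𝓝 (g₀ x))) :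
    Tendsto (fun m => (1 / dt m) * ∫ p in {p : ℝ × ℝ | 0 ≤ p.2 ∧ p.2 < dt m}, G m p * φ p) atTop
      (𝓝 (∫ x, g₀ x * φ (x, 0))) := by
  -- The mesh ratio `1` is arbitrary: only the bounds on `φ` itself are kept.
  obtain ⟨L, R, hL, hR, hφL, hlip, hsupp, -, -⟩ :=
    exists_testFunction_bounds hφ hφc one_pos
  have hφm : ∀ m, IntegrableOn (fun p : ℝ × ℝ => g m p.1 * φ p) (univ ×ˢ Ico 0 (dt m))
      (volume.prod volume) := fun m => by
    have := integrable_bdd_mul_of_compactSupport (φ := φ) (g := fun p : ℝ × ℝ => g m p.1)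
      ((hg m).comp measurable_fst) (fun p => hgM m p.1) hφ.continuous hφc
    rw [Measure.volume_eq_prod] at this
    exact this.integrableOn
  -- In the first layer `G m` does not depend on time, so by Fubini the time average falls on `φ`
  -- alone.
  have key : ∀ m, (1 / dt m) * ∫ p in {p : ℝ × ℝ | 0 ≤ p.2 ∧ p.2 < dt m}, G m p * φ p =
      ∫ x, g m x * ((1 / dt m) * ∫ t in Ico 0 (dt m), φ (x, t)) := fun m => by
    have hset : {p : ℝ × ℝ | 0 ≤ p.2 ∧ p.2 < dt m} = univ ×ˢ Ico 0 (dt m) := by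
      ext p; simp
    have h1 : ∫ p in {p : ℝ × ℝ | 0 ≤ p.2 ∧ p.2 < dt m}, G m p * φ p =
        ∫ p in univ ×ˢ Ico 0 (dt m), g m p.1 * φ p := by
      rw [hset]
      refine setIntegral_congr_fun (MeasurableSet.univ.prod measurableSet_Ico) fun p hp => ?_
      rw [hG m p hp.2.1 hp.2.2]
    rw [h1, Measure.volume_eq_prod, setIntegral_prod _ (hφm m), setIntegral_univ,
      ← integral_const_mul]
    refine integral_congr_ae (Eventually.of_forall fun x => ?_)
    dsimp only
    rw [integral_const_mul]
    ring
  simp_rw [key]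
  have hint : ∀ m x, IntegrableOn (fun t => φ (x, t)) (Ico 0 (dt m)) := fun m x =>
    ((hφ.continuous.comp (by fun_prop : Continuous fun t : ℝ => (x, t))).integrableOn_Icc).mono_set
      Ico_subset_Icc_self
  have hdist : ∀ m x, |(1 / dt m) * (∫ t in Ico 0 (dt m), φ (x, t)) - φ (x, 0)| ≤ L * dt m := by
    intro m x
    have hc : φ (x, 0) = (1 / dt m) * ∫ t in Ico 0 (dt m), φ (x, 0) := by
      rw [setIntegral_const, Real.volume_real_Ico_of_le (hpos m).le, sub_zero, smul_eq_mul]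
      field_simp [(hpos m).ne']
    rw [hc, ← mul_sub, ← integral_sub (hint m x) (integrableOn_const (by simp)), abs_mul,
      abs_of_pos (one_div_pos.2 (hpos m)), one_div, inv_mul_le_iff₀ (hpos m)]
    have := norm_setIntegral_le_of_norm_le_const (μ := volume) (s := Ico 0 (dt m))
      (f := fun t => φ (x, t) - φ (x, 0)) (C := L * dt m) (by simp) (fun t ht => by
        refine (hlip _ _).trans (mul_le_mul_of_nonneg_left ?_ hL.le)
        rw [Prod.mk_sub_mk, sub_self, sub_zero, Prod.norm_def]
        simp only [norm_zero, Real.norm_eq_abs]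
        exact max_le (hpos m).le (by rw [abs_of_nonneg ht.1]; exact ht.2.le))
    rw [Real.volume_real_Ico_of_le (hpos m).le, sub_zero] at this
    rw [← Real.norm_eq_abs]
    linarith
  refine tendsto_integral_filter_of_dominated_convergence
    (fun x => M * (Icc (-R) R).indicator (fun _ => L) x) (Eventually.of_forall fun m => ?_)
    (Eventually.of_forall fun m => Eventually.of_forall fun x => ?_) ?_ ?_
  · refine (hg m).aestronglyMeasurable.mul (AEStronglyMeasurable.const_mul ?_ _)
    exact (hφ.continuous.stronglyMeasurable.integral_prod_right'
      (ν := volume.restrict (Ico 0 (dt m)))).aestronglyMeasurable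
  · rw [Real.norm_eq_abs, abs_mul]
    refine mul_le_mul (hgM m x) ?_ (abs_nonneg _) ((abs_nonneg _).trans (hgM m x))
    by_cases hx : x ∈ Icc (-R) R
    · rw [indicator_of_mem hx, abs_mul, abs_of_pos (one_div_pos.2 (hpos m)), one_div,
        inv_mul_le_iff₀ (hpos m)]
      have := norm_setIntegral_le_of_norm_le_const (μ := volume) (s := Ico 0 (dt m))
        (f := fun t => φ (x, t)) (C := L) (by simp) (fun t _ => hφL _)
      rw [Real.volume_real_Ico_of_le (hpos m).le, sub_zero] at this
      rw [← Real.norm_eq_abs]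
      linarith
    · have z : ∀ t, φ (x, t) = 0 := fun t => by
        by_contra h
        refine hx ?_
        have h1 := hsupp _ h
        have h2 : |x| ≤ R := (norm_fst_le (x, t)).trans h1
        exact abs_le.1 h2
      rw [indicator_of_notMem hx]
      simp [z]
  · exact ((integrable_indicator_iff measurableSet_Icc).2
      (integrableOn_const (by simp))).const_mul M
  · filter_upwards [hlim] with x hx
    refine hx.mul ?_
    rw [tendsto_iff_dist_tendsto_zero]
    refine squeeze_zero (fun m => dist_nonneg) (fun m => hdist m x) ?_
    simpa using hdt.const_mul L

/-! ### Affine dependence of the flux on the coefficient -/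

/-- A `C²` function on an interval with vanishing second derivative is affine. -/
theorem eq_affine_of_iteratedDerivWithin_two_eq_zero {g : ℝ → ℝ} {a b : ℝ} (hab : a < b)
    (hg : ContDiffOn ℝ 2 g (Icc a b))
    (h0 : ∀ x ∈ Icc a b, iteratedDerivWithin 2 g (Icc a b) x = 0) {x : ℝ} (hx : x ∈ Icc a b) :
    g x = g a + (x - a) * ((g b - g a) / (b - a)) := by
  have hu : UniqueDiffOn ℝ (Icc a b) := uniqueDiffOn_Icc hab
  set d := derivWithin g (Icc a b) with hd
  have hdd : DifferentiableOn ℝ d (Icc a b) := by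
    have := hg.derivWithin hu (m := 1) (by norm_num)
    exact this.differentiableOn (by norm_num)
  have hd0 : ∀ x ∈ Icc a b, derivWithin d (Icc a b) x = 0 := fun x hx => by
    rw [← h0 x hx, iteratedDerivWithin_succ]
    refine derivWithin_congr (fun y hy => ?_) ?_
    · rw [iteratedDerivWithin_one]
    · rw [iteratedDerivWithin_one]
  have hdc : ∀ x ∈ Icc a b, d x = d a :=
    constant_of_derivWithin_zero hdd fun x hx => hd0 x (Ico_subset_Icc_self hx)
  have hgd : DifferentiableOn ℝ g (Icc a b) := hg.differentiableOn (by norm_num)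
  have key : ∀ x ∈ Icc a b, g x - x * d a = g a - a * d a := by
    refine constant_of_derivWithin_zero (f := fun x => g x - x * d a)
      (hgd.sub (differentiableOn_id.mul_const _)) fun x hx => ?_
    have hx' := Ico_subset_Icc_self hx
    have h1 : HasDerivWithinAt (fun x => g x - x * d a) (derivWithin g (Icc a b) x - 1 * d a)
        (Icc a b) x := ((hgd x hx').hasDerivWithinAt).sub
      ((hasDerivWithinAt_id x (Icc a b)).mul_const (d a))
    rw [HasDerivWithinAt.derivWithin h1 (hu x hx'), one_mul, ← hd, hdc x hx', sub_self]
  have k1 := key x hx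
  have k2 := key b ⟨hab.le, le_rfl⟩
  have : d a = (g b - g a) / (b - a) := by
    rw [eq_div_iff (by linarith)]
    linarith
  rw [← this]
  linarith

/-- The flux is affine in the coefficient, and the two coefficient functions are Lipschitz in the
state. -/
theorem exists_affine_flux {f : ℝ → ℝ → ℝ} {kl ku ul uu lam : ℝ} (hlam : 0 < lam)
    (hkk : kl ≤ ku) (hf_k : ∀ v : ℝ, ContDiffOn ℝ 2 (fun κ => f κ v) (Icc kl ku))
    (hf_kk : ∀ v : ℝ, ∀ κ ∈ Icc kl ku,
      iteratedDerivWithin 2 (fun κ' => f κ' v) (Icc kl ku) κ = 0)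
    (hLip : ∀ κ ∈ Icc kl ku, ∀ v ∈ Icc ul uu, ∀ w ∈ Icc ul uu,
      lam * |f κ v - f κ w| ≤ 1 / 2 * |v - w|) :
    ∃ (A B : ℝ → ℝ) (C : ℝ), (∀ κ ∈ Icc kl ku, ∀ v, f κ v = A v + κ * B v) ∧
      ∀ v ∈ Icc ul uu, ∀ w ∈ Icc ul uu, |A v - A w| ≤ C * |v - w| ∧ |B v - B w| ≤ C * |v - w| := by
  have hL : ∀ κ ∈ Icc kl ku, ∀ v ∈ Icc ul uu, ∀ w ∈ Icc ul uu,
      |f κ v - f κ w| ≤ 1 / (2 * lam) * |v - w| := fun κ hκ v hv w hw => by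
    have h1 := hLip κ hκ v hv w hw
    have e : 1 / (2 * lam) * |v - w| = 1 / 2 * |v - w| / lam := by field_simp
    rw [e, le_div_iff₀ hlam]
    linarith
  have hl : kl ∈ Icc kl ku := ⟨le_rfl, hkk⟩
  have hu : ku ∈ Icc kl ku := ⟨hkk, le_rfl⟩
  set l := 1 / (2 * lam) with hl_def
  have hl0 : 0 ≤ l := by positivity
  -- If `kl = ku` the secant slope is undefined, and `B = 0` serves. Otherwise `B v` is the slope of
  -- `κ ↦ f κ v` between `kl` and `ku`, and is Lipschitz because `f kl` and `f ku` are. The affine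
  -- formula itself holds for every real `v`, as needed for arbitrary `c`.
  rcases hkk.eq_or_lt with h | h
  · refine ⟨f kl, fun _ => 0, l, fun κ hκ v => ?_, fun v hv w hw => ⟨hL _ hl v hv w hw, ?_⟩⟩
    · rw [le_antisymm (h ▸ hκ.2) hκ.1]
      simp
    · simpa using mul_nonneg hl0 (abs_nonneg (v - w))
  · set s := (ku - kl)⁻¹ with hs
    have hs0 : 0 ≤ s := inv_nonneg.2 (by linarith)
    have hB : ∀ v ∈ Icc ul uu, ∀ w ∈ Icc ul uu,
        |(f ku v - f kl v) * s - (f ku w - f kl w) * s| ≤ 2 * l * s * |v - w| :=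
      fun v hv w hw => by
        have e : (f ku v - f kl v) * s - (f ku w - f kl w) * s =
            ((f ku v - f ku w) - (f kl v - f kl w)) * s := by ring
        rw [e, abs_mul, abs_of_nonneg hs0]
        have h1 := abs_sub (f ku v - f ku w) (f kl v - f kl w)
        have h2 := hL _ hl v hv w hw
        have h3 := hL _ hu v hv w hw
        have := mul_le_mul_of_nonneg_right (h1.trans (add_le_add h3 h2)) hs0
        linarith
    refine ⟨fun v => f kl v - kl * ((f ku v - f kl v) * s), fun v => (f ku v - f kl v) * s,
      l + |kl| * (2 * l * s) + 2 * l * s, fun κ hκ v => ?_, fun v hv w hw => ?_⟩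
    · have := eq_affine_of_iteratedDerivWithin_two_eq_zero h (hf_k v) (hf_kk v) hκ
      rw [this, hs]
      field_simp
      ring
    · have h1 := hB v hv w hw
      have h2 := hL _ hl v hv w hw
      have a0 := abs_nonneg (v - w)
      have z1 : 0 ≤ l * |v - w| := mul_nonneg hl0 a0
      have z2 : 0 ≤ |kl| * (2 * l * s * |v - w|) := by positivity
      have z3 : 0 ≤ 2 * l * s * |v - w| := by positivity
      constructor
      · have e : f kl v - kl * ((f ku v - f kl v) * s) - (f kl w - kl * ((f ku w - f kl w) * s)) =
            (f kl v - f kl w) - kl * ((f ku v - f kl v) * s - (f ku w - f kl w) * s) := by ring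
        rw [e]
        refine (abs_sub _ _).trans ?_
        rw [abs_mul]
        have := mul_le_mul_of_nonneg_left h1 (abs_nonneg kl)
        nlinarith
      · nlinarith

/-! ### Kruzhkov inequalities for the scheme and their regularization -/

/-- The mean of `g` over `[c, c + ε]`. -/
noncomputable def forwardMean (c ε : ℝ) (g : ℝ → ℝ) : ℝ := (1 / ε) * ∫ s in c..(c + ε), g s

theorem abs_forwardMean_sub_le {c ε C : ℝ} (hε : 0 < ε) {g : ℝ → ℝ}
    (hg : ContinuousOn g (Icc c (c + ε))) (hC : 0 ≤ C)
    (h : ∀ s ∈ Icc c (c + ε), |g s - g c| ≤ C * |s - c|) :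
    |forwardMean c ε g - g c| ≤ C * ε := by
  have hle : c ≤ c + ε := by linarith
  have e : ∀ y : ℝ, y = (1 / ε) * ∫ s in c..(c + ε), y := fun y => by
    rw [intervalIntegral.integral_const, smul_eq_mul]
    field_simp
    ring
  have hgi : IntervalIntegrable g volume c (c + ε) :=
    ContinuousOn.intervalIntegrable (by rwa [uIcc_of_le hle])
  rw [forwardMean, e (g c), ← mul_sub, ← intervalIntegral.integral_sub hgi intervalIntegrable_const, abs_mul,
    abs_of_pos (one_div_pos.2 hε), one_div, inv_mul_le_iff₀ hε]
  have := intervalIntegral.norm_integral_le_of_norm_le_const (a := c) (b := c + ε)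
    (f := fun s => g s - g c) (C := C * ε) fun s hs => by
      rw [uIoc_of_le hle] at hs
      refine (h s (Ioc_subset_Icc_self hs)).trans (mul_le_mul_of_nonneg_left ?_ hC)
      rw [abs_of_pos (by linarith [hs.1])]
      linarith [hs.2]
  rw [add_sub_cancel_left, abs_of_pos hε, Real.norm_eq_abs] at this
  linarith

/-- The Kruzhkov entropy flux, in a form that is visibly Lipschitz. -/
theorem sign_mul_sub_eq (g : ℝ → ℝ) (v s : ℝ) :
    Real.sign (v - s) * (g v - g s) = g (max v s) - g (min v s) := by
  rcases lt_trichotomy v s with h | h | h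
  · rw [Real.sign_of_neg (by linarith), max_eq_right h.le, min_eq_left h.le]; ring
  · simp [h]
  · rw [Real.sign_of_pos (by linarith), max_eq_left h.le, min_eq_right h.le]; ring

theorem max_mem_Icc' {a b v s : ℝ} (hv : v ∈ Icc a b) (hs : s ∈ Icc a b) : max v s ∈ Icc a b :=
  ⟨hv.1.trans (le_max_left _ _), max_le hv.2 hs.2⟩

theorem min_mem_Icc' {a b v s : ℝ} (hv : v ∈ Icc a b) (hs : s ∈ Icc a b) : min v s ∈ Icc a b :=
  ⟨le_min hv.1 hs.1, (min_le_left _ _).trans hv.2⟩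

/-- The Lax–Friedrichs step is monotone, hence satisfies a Kruzhkov entropy inequality. -/
theorem laxFriedrichs_kruzhkov {g₁ g₂ : ℝ → ℝ} {lam ul uu : ℝ} (hlam : 0 < lam)
    (h₁ : ∀ v ∈ Icc ul uu, ∀ w ∈ Icc ul uu, lam * |g₁ v - g₁ w| ≤ 1 / 2 * |v - w|)
    (h₂ : ∀ v ∈ Icc ul uu, ∀ w ∈ Icc ul uu, lam * |g₂ v - g₂ w| ≤ 1 / 2 * |v - w|)
    {u₁ u₂ s : ℝ} (hu₁ : u₁ ∈ Icc ul uu) (hu₂ : u₂ ∈ Icc ul uu) (hs : s ∈ Icc ul uu) :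
    |1 / 2 * (u₁ + u₂) - lam * (g₂ u₂ - g₁ u₁) - s| ≤
      1 / 2 * (|u₁ - s| + |u₂ - s|) -
        lam * ((g₂ (max u₂ s) - g₂ (min u₂ s)) - (g₁ (max u₁ s) - g₁ (min u₁ s))) +
        lam * |g₂ s - g₁ s| := by
  -- The step minus `s` splits into one term per neighbour and the source `- lam * (g₂ s - g₁ s)`.
  -- By the CFL bound `v ↦ v / 2 ± lam * g v` is nondecreasing, so each term has the sign of `u - s`
  -- and its absolute value is the corresponding part of entropy and flux.
  have k₁ : |1 / 2 * (u₁ - s) + lam * (g₁ u₁ - g₁ s)| ≤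
      1 / 2 * |u₁ - s| + lam * (g₁ (max u₁ s) - g₁ (min u₁ s)) := by
    have h := h₁ u₁ hu₁ s hs
    have p1 := mul_le_mul_of_nonneg_left (le_abs_self (g₁ u₁ - g₁ s)) hlam.le
    have p2 := mul_le_mul_of_nonneg_left (neg_abs_le (g₁ u₁ - g₁ s)) hlam.le
    rcases le_total u₁ s with h' | h'
    · rw [max_eq_right h', min_eq_left h', abs_of_nonpos (by linarith : u₁ - s ≤ 0)]
      rw [abs_of_nonpos (by linarith : u₁ - s ≤ 0)] at h
      rw [abs_le]; constructor <;> linarith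
    · rw [max_eq_left h', min_eq_right h', abs_of_nonneg (by linarith : 0 ≤ u₁ - s)]
      rw [abs_of_nonneg (by linarith : 0 ≤ u₁ - s)] at h
      rw [abs_le]; constructor <;> linarith
  have k₂ : |1 / 2 * (u₂ - s) - lam * (g₂ u₂ - g₂ s)| ≤
      1 / 2 * |u₂ - s| - lam * (g₂ (max u₂ s) - g₂ (min u₂ s)) := by
    have h := h₂ u₂ hu₂ s hs
    have p1 := mul_le_mul_of_nonneg_left (le_abs_self (g₂ u₂ - g₂ s)) hlam.le
    have p2 := mul_le_mul_of_nonneg_left (neg_abs_le (g₂ u₂ - g₂ s)) hlam.le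
    rcases le_total u₂ s with h' | h'
    · rw [max_eq_right h', min_eq_left h', abs_of_nonpos (by linarith : u₂ - s ≤ 0)]
      rw [abs_of_nonpos (by linarith : u₂ - s ≤ 0)] at h
      rw [abs_le]; constructor <;> linarith
    · rw [max_eq_left h', min_eq_right h', abs_of_nonneg (by linarith : 0 ≤ u₂ - s)]
      rw [abs_of_nonneg (by linarith : 0 ≤ u₂ - s)] at h
      rw [abs_le]; constructor <;> linarith
  have k₃ := mul_le_mul_of_nonneg_left (le_abs_self (g₂ s - g₁ s)) hlam.le
  have k₄ := mul_le_mul_of_nonneg_left (neg_abs_le (g₂ s - g₁ s)) hlam.le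
  obtain ⟨a1, a2⟩ := abs_le.1 k₁
  obtain ⟨b1, b2⟩ := abs_le.1 k₂
  rw [abs_le]
  constructor <;> linarith

/-- A subgradient of `|· - s|` integrated over `s`. -/
theorem integral_subgradient (w c ε : ℝ) :
    IntervalIntegrable (fun s => if s ≤ w then (1 : ℝ) else -1) volume c (c + ε) ∧
    ∫ s in c..(c + ε), (if s ≤ w then (1 : ℝ) else -1) = |w - c| - |w - (c + ε)| := by
  have hi : IntervalIntegrable (fun s => if s ≤ w then (1 : ℝ) else -1) volume c (c + ε) := by
    refine AntitoneOn.intervalIntegrable fun x _ y _ hxy => ?_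
    split_ifs <;> linarith
  refine ⟨hi, ?_⟩
  -- The antiderivative `-|w - s|` fails to be differentiable only at `s = w`.
  rw [integral_eq_of_hasDerivAt_off_countable (fun s => -|w - s|) _ (countable_singleton w)
    (by fun_prop) (fun x hx => ?_) hi]
  · ring
  · have hne : x ≠ w := hx.2
    rcases lt_or_gt_of_ne hne with h | h
    · simp only [h.le, if_true]
      have h1 : HasDerivAt (fun s : ℝ => -(w - s)) 1 x := by
        convert! ((hasDerivAt_id x).const_sub w).neg using 1
        norm_num
      refine h1.congr_of_eventuallyEq ?_
      filter_upwards [Iio_mem_nhds h] with s hs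
      rw [abs_of_pos (by linarith [mem_Iio.1 hs])]
    · simp only [not_le.2 h, if_false]
      have h1 : HasDerivAt (fun s : ℝ => w - s) (-1) x := by
        simpa using (hasDerivAt_id x).const_sub w
      refine h1.congr_of_eventuallyEq ?_
      filter_upwards [Ioi_mem_nhds h] with s hs
      rw [abs_of_neg (by linarith [mem_Ioi.1 hs]), neg_neg]

/-- Convexity, with the subgradient taken at the corrected value `w` and not at the predictor `z`:
the cubic estimate controls jumps of corrected values only. -/
theorem abs_sub_le_subgradient (w z s : ℝ) :
    |w - s| ≤ |z - s| + (if s ≤ w then (1 : ℝ) else -1) * (w - z) := by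
  split_ifs with h
  · rw [abs_of_nonneg (by linarith : 0 ≤ w - s)]
    linarith [le_abs_self (z - s)]
  · rw [abs_of_neg (by linarith : w - s < 0)]
    linarith [neg_abs_le (z - s)]

theorem forwardMean_add {c ε : ℝ} {g h : ℝ → ℝ} (hg : IntervalIntegrable g volume c (c + ε))
    (hh : IntervalIntegrable h volume c (c + ε)) :
    forwardMean c ε (fun s => g s + h s) = forwardMean c ε g + forwardMean c ε h := by
  rw [forwardMean, intervalIntegral.integral_add hg hh, mul_add]; rfl

theorem forwardMean_sub {c ε : ℝ} {g h : ℝ → ℝ} (hg : IntervalIntegrable g volume c (c + ε))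
    (hh : IntervalIntegrable h volume c (c + ε)) :
    forwardMean c ε (fun s => g s - h s) = forwardMean c ε g - forwardMean c ε h := by
  rw [forwardMean, intervalIntegral.integral_sub hg hh, mul_sub]; rfl

theorem forwardMean_const_mul (c ε a : ℝ) (g : ℝ → ℝ) :
    forwardMean c ε (fun s => a * g s) = a * forwardMean c ε g := by
  rw [forwardMean, intervalIntegral.integral_const_mul, forwardMean]; ring

theorem forwardMean_mul_const (c ε a : ℝ) (g : ℝ → ℝ) :
    forwardMean c ε (fun s => g s * a) = forwardMean c ε g * a := by
  rw [forwardMean, intervalIntegral.integral_mul_const, forwardMean]; ring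

theorem forwardMean_mono {c ε : ℝ} (hε : 0 < ε) {g h : ℝ → ℝ}
    (hg : IntervalIntegrable g volume c (c + ε)) (hh : IntervalIntegrable h volume c (c + ε))
    (hle : ∀ s ∈ Icc c (c + ε), g s ≤ h s) : forwardMean c ε g ≤ forwardMean c ε h :=
  mul_le_mul_of_nonneg_left (intervalIntegral.integral_mono_on (by linarith) hg hh hle)
    (one_div_pos.2 hε).le

/-- The Lipschitz estimate for the Kruzhkov entropy flux as a function of the Kruzhkov
parameter. -/
theorem abs_kruzhkovFlux_sub_le {g : ℝ → ℝ} {ul uu l : ℝ} (hl : 0 ≤ l)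
    (hg : ∀ v ∈ Icc ul uu, ∀ w ∈ Icc ul uu, |g v - g w| ≤ l * |v - w|) {v s r : ℝ}
    (hv : v ∈ Icc ul uu) (hs : s ∈ Icc ul uu) (hr : r ∈ Icc ul uu) :
    |(g (max v s) - g (min v s)) - (g (max v r) - g (min v r))| ≤ 2 * l * |s - r| := by
  have h1 := hg _ (max_mem_Icc' hv hs) _ (max_mem_Icc' hv hr)
  have h2 := hg _ (min_mem_Icc' hv hs) _ (min_mem_Icc' hv hr)
  have m1 : |max v s - max v r| ≤ |s - r| := by
    simpa using abs_max_sub_max_le_max v s v r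
  have m2 : |min v s - min v r| ≤ |s - r| := by
    simpa using abs_min_sub_min_le_max v s v r
  have e : (g (max v s) - g (min v s)) - (g (max v r) - g (min v r)) =
      (g (max v s) - g (max v r)) - (g (min v s) - g (min v r)) := by ring
  rw [e]
  refine (abs_sub _ _).trans ?_
  have := mul_le_mul_of_nonneg_left m1 hl
  have := mul_le_mul_of_nonneg_left m2 hl
  linarith

theorem continuousOn_of_abs_sub_le {g : ℝ → ℝ} {S : Set ℝ} {l : ℝ}
    (h : ∀ s ∈ S, ∀ r ∈ S, |g s - g r| ≤ l * |s - r|) : ContinuousOn g S := by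
  refine LipschitzOnWith.continuousOn (K := l.toNNReal)
    (LipschitzOnWith.of_dist_le_mul fun s hs r hr => ?_)
  rw [Real.dist_eq, Real.dist_eq]
  exact (h s hs r hr).trans (mul_le_mul_of_nonneg_right (Real.le_coe_toNNReal l) (abs_nonneg _))

/-- Regularized Kruzhkov entropies for the scheme: `Ψ`, `Q`, `r` approximate the entropy
`|· - c|`, its flux and the coefficient of the source term, and `p` is a Lipschitz subgradient
which controls the effect of the corrections `a₁`, `a₂`. -/
theorem exists_regularized_entropy {f : ℝ → ℝ → ℝ} {kl ku ul uu lam : ℝ} (hlam : 0 < lam)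
    (hLip : ∀ κ ∈ Icc kl ku, ∀ v ∈ Icc ul uu, ∀ w ∈ Icc ul uu,
      lam * |f κ v - f κ w| ≤ 1 / 2 * |v - w|) {A B : ℝ → ℝ} {C₀ : ℝ}
    (hf : ∀ κ ∈ Icc kl ku, ∀ v, f κ v = A v + κ * B v)
    (hB : ∀ v ∈ Icc ul uu, ∀ w ∈ Icc ul uu, |B v - B w| ≤ C₀ * |v - w|) (c : ℝ) :
    ∃ C ε₀ : ℝ, 0 ≤ C ∧ 0 < ε₀ ∧ ∀ ε, 0 < ε → ε ≤ ε₀ →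
      ∃ (Ψ p : ℝ → ℝ) (Q : ℝ → ℝ → ℝ) (r : ℝ), 0 ≤ r ∧
        (∀ v ∈ Icc ul uu, abs (Ψ v - |v - c|) ≤ C * ε) ∧
        (∀ κ ∈ Icc kl ku, ∀ v ∈ Icc ul uu,
          |Q κ v - Real.sign (v - c) * (f κ v - f κ c)| ≤ C * ε) ∧
        abs (r - |B c|) ≤ C * ε ∧ (∀ v, |p v| ≤ 1) ∧ (∀ v w, |p v - p w| ≤ 2 / ε * |v - w|) ∧
        ∀ κ₁ ∈ Icc kl ku, ∀ κ₂ ∈ Icc kl ku, ∀ u₁ ∈ Icc ul uu, ∀ u₂ ∈ Icc ul uu,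
          ∀ w ∈ Icc ul uu, ∀ a₁ a₂ : ℝ,
          w = 1 / 2 * (u₁ + u₂) - lam * (f κ₂ u₂ - f κ₁ u₁) - a₂ + a₁ →
          Ψ w ≤ 1 / 2 * (Ψ u₁ + Ψ u₂) - lam * (Q κ₂ u₂ - Q κ₁ u₁) + lam * (r * |κ₂ - κ₁|) +
            p w * (a₁ - a₂) := by
  -- Affinity in `κ` separates the source into a factor depending on `s` and the increment of the
  -- coefficient; averaging in `s` then touches only `|B s|`.
  have hfc : ∀ κ₁ ∈ Icc kl ku, ∀ κ₂ ∈ Icc kl ku, ∀ s, |f κ₂ s - f κ₁ s| = |B s| * |κ₂ - κ₁| :=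
    fun κ₁ h₁ κ₂ h₂ s => by
      rw [hf κ₁ h₁, hf κ₂ h₂, ← abs_mul]
      congr 1
      ring
  -- For `c` outside `[ul, uu)` the entropy is linear on the range of the scheme, so no averaging is
  -- needed and the subgradient is the constant `σ`.
  have linear : ∀ σ : ℝ, |σ| = 1 → (∀ v ∈ Icc ul uu, |v - c| = σ * (v - c)) →
      (∀ κ ∈ Icc kl ku, ∀ v ∈ Icc ul uu,
        Real.sign (v - c) * (f κ v - f κ c) = σ * (f κ v - f κ c)) →
      ∃ C ε₀ : ℝ, 0 ≤ C ∧ 0 < ε₀ ∧ ∀ ε, 0 < ε → ε ≤ ε₀ →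
      ∃ (Ψ p : ℝ → ℝ) (Q : ℝ → ℝ → ℝ) (r : ℝ), 0 ≤ r ∧
        (∀ v ∈ Icc ul uu, abs (Ψ v - |v - c|) ≤ C * ε) ∧
        (∀ κ ∈ Icc kl ku, ∀ v ∈ Icc ul uu,
          |Q κ v - Real.sign (v - c) * (f κ v - f κ c)| ≤ C * ε) ∧
        abs (r - |B c|) ≤ C * ε ∧ (∀ v, |p v| ≤ 1) ∧ (∀ v w, |p v - p w| ≤ 2 / ε * |v - w|) ∧
        ∀ κ₁ ∈ Icc kl ku, ∀ κ₂ ∈ Icc kl ku, ∀ u₁ ∈ Icc ul uu, ∀ u₂ ∈ Icc ul uu,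
          ∀ w ∈ Icc ul uu, ∀ a₁ a₂ : ℝ,
          w = 1 / 2 * (u₁ + u₂) - lam * (f κ₂ u₂ - f κ₁ u₁) - a₂ + a₁ →
          Ψ w ≤ 1 / 2 * (Ψ u₁ + Ψ u₂) - lam * (Q κ₂ u₂ - Q κ₁ u₁) + lam * (r * |κ₂ - κ₁|) +
            p w * (a₁ - a₂) := by
    intro σ hσ h1 h2
    refine ⟨0, 1, le_rfl, one_pos, fun ε hε _ => ⟨fun v => σ * (v - c), fun _ => σ,
      fun κ v => σ * (f κ v - f κ c), |B c|, abs_nonneg _, fun v hv => ?_, fun κ hκ v hv => ?_,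
      by simp, fun _ => hσ.le, fun v w => ?_, ?_⟩⟩
    · simp [h1 v hv]
    · simp [h2 κ hκ v hv]
    · rw [sub_self, abs_zero]; positivity
    · intro κ₁ hκ₁ κ₂ hκ₂ u₁ _ u₂ _ w _ a₁ a₂ hw
      have h3 := hfc κ₁ hκ₁ κ₂ hκ₂ c
      rw [← h3]
      have h4 : -(σ * (f κ₂ c - f κ₁ c)) ≤ |f κ₂ c - f κ₁ c| := by
        have := neg_le_abs (σ * (f κ₂ c - f κ₁ c))
        rwa [abs_mul, hσ, one_mul] at this
      have h5 := mul_le_mul_of_nonneg_left h4 hlam.le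
      rw [hw]
      nlinarith
  rcases lt_or_ge c ul with hc | hc
  · refine linear 1 (by simp) (fun v hv => ?_) fun κ _ v hv => ?_
    · rw [abs_of_nonneg (by linarith [hv.1]), one_mul]
    · rw [Real.sign_of_pos (by linarith [hv.1])]
  rcases le_or_gt uu c with hc' | hc'
  · refine linear (-1) (by simp) (fun v hv => ?_) fun κ _ v hv => ?_
    · rw [abs_of_nonpos (by linarith [hv.2]), neg_one_mul]
    · rcases (hv.2.trans hc').eq_or_lt with h | h
      · simp [h]
      · rw [Real.sign_of_neg (by linarith)]
  have hcm : c ∈ Icc ul uu := ⟨hc, hc'.le⟩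
  have hC₀ : 0 ≤ C₀ := by
    have h := (abs_nonneg _).trans (hB c hcm uu ⟨by linarith, le_rfl⟩)
    have : 0 < |c - uu| := abs_pos.2 (by linarith)
    exact nonneg_of_mul_nonneg_left h this
  set l := 1 / (2 * lam) with hl_def
  have hl : 0 ≤ l := by positivity
  have hfl : ∀ κ ∈ Icc kl ku, ∀ v ∈ Icc ul uu, ∀ w ∈ Icc ul uu,
      |f κ v - f κ w| ≤ l * |v - w| := fun κ hκ v hv w hw => by
    have h1 := hLip κ hκ v hv w hw
    have e : l * |v - w| = 1 / 2 * |v - w| / lam := by rw [hl_def]; field_simp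
    rw [e, le_div_iff₀ hlam]
    linarith
  -- The summands are Lipschitz constants in the Kruzhkov parameter: `1` for the entropy, `2 * l`
  -- for its flux, `C₀` for `|B|`. The bound `ε ≤ uu - c` keeps `[c, c + ε]` inside `[ul, uu]`,
  -- where the CFL bound is available.
  refine ⟨1 + 2 * l + C₀, uu - c, by positivity, by linarith, fun ε hε hε' => ?_⟩
  have hsub : Icc c (c + ε) ⊆ Icc ul uu := fun s hs => ⟨hc.trans hs.1, by linarith [hs.2]⟩
  have hcc : c ∈ Icc c (c + ε) := ⟨le_rfl, by linarith⟩
  set F : ℝ → ℝ → ℝ → ℝ := fun κ v s => f κ (max v s) - f κ (min v s) with hF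
  have hFl : ∀ κ ∈ Icc kl ku, ∀ v ∈ Icc ul uu, ∀ s ∈ Icc c (c + ε), ∀ r ∈ Icc c (c + ε),
      |F κ v s - F κ v r| ≤ 2 * l * |s - r| := fun κ hκ v hv s hs r hr =>
    abs_kruzhkovFlux_sub_le hl (hfl κ hκ) hv (hsub hs) (hsub hr)
  have hFc : ∀ κ ∈ Icc kl ku, ∀ v ∈ Icc ul uu, ContinuousOn (F κ v) (Icc c (c + ε)) :=
    fun κ hκ v hv => continuousOn_of_abs_sub_le (hFl κ hκ v hv)
  have hBl : ∀ s ∈ Icc c (c + ε), ∀ r ∈ Icc c (c + ε), abs (|B s| - |B r|) ≤ C₀ * |s - r| :=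
    fun s hs r hr => (abs_abs_sub_abs_le _ _).trans (hB s (hsub hs) r (hsub hr))
  have hBc : ContinuousOn (fun s => |B s|) (Icc c (c + ε)) := continuousOn_of_abs_sub_le hBl
  have hii : ∀ g : ℝ → ℝ, ContinuousOn g (Icc c (c + ε)) →
      IntervalIntegrable g volume c (c + ε) := fun g hg =>
    ContinuousOn.intervalIntegrable (by rwa [uIcc_of_le (by linarith)])
  have hle : ∀ x : ℝ, 0 ≤ x → x ≤ 1 + 2 * l + C₀ → x * ε ≤ (1 + 2 * l + C₀) * ε :=
    fun x _ hx => mul_le_mul_of_nonneg_right hx hε.le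
  -- The subgradient `p` is the derivative of the averaged entropy, that is, the mean of the
  -- sign-type subgradients over `[c, c + ε]`.
  refine ⟨fun v => forwardMean c ε fun s => |v - s|, fun v => (|v - c| - |v - (c + ε)|) / ε,
    fun κ v => forwardMean c ε (F κ v), forwardMean c ε fun s => |B s|, ?_, fun v hv => ?_,
    fun κ hκ v hv => ?_, ?_, fun v => ?_, fun v w => ?_, ?_⟩
  · exact mul_nonneg (one_div_pos.2 hε).le
      (intervalIntegral.integral_nonneg (by linarith) fun s _ => abs_nonneg _)
  · refine (abs_forwardMean_sub_le hε (g := fun s => |v - s|) (C := 1) (by fun_prop) zero_le_one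
      fun s hs => ?_).trans (hle 1 zero_le_one (by linarith))
    rw [one_mul]
    refine (abs_abs_sub_abs_le _ _).trans (le_of_eq ?_)
    rw [abs_sub_comm s c]; congr 1; ring
  · rw [sign_mul_sub_eq]
    exact (abs_forwardMean_sub_le hε (hFc κ hκ v hv) (by positivity) fun s hs =>
      hFl κ hκ v hv s hs c hcc).trans (hle (2 * l) (by positivity) (by linarith))
  · exact (abs_forwardMean_sub_le hε hBc hC₀ fun s hs => hBl s hs c hcc).trans
      (hle C₀ hC₀ (by linarith))
  · rw [abs_div, abs_of_pos hε, div_le_one hε]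
    refine (abs_abs_sub_abs_le _ _).trans (le_of_eq ?_)
    rw [show v - c - (v - (c + ε)) = ε by ring, abs_of_pos hε]
  · rw [← sub_div, abs_div, abs_of_pos hε, div_mul_eq_mul_div]
    refine div_le_div_of_nonneg_right ?_ hε.le
    have h1 := abs_abs_sub_abs_le (v - c) (w - c)
    have h2 := abs_abs_sub_abs_le (v - (c + ε)) (w - (c + ε))
    rw [sub_sub_sub_cancel_right] at h1 h2
    rw [show |v - c| - |v - (c + ε)| - (|w - c| - |w - (c + ε)|) =
      (|v - c| - |w - c|) - (|v - (c + ε)| - |w - (c + ε)|) by ring]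
    refine (abs_sub _ _).trans ?_
    linarith
  · intro κ₁ hκ₁ κ₂ hκ₂ u₁ hu₁ u₂ hu₂ w hw a₁ a₂ hwe
    obtain ⟨hσi, hσ⟩ := integral_subgradient w c ε
    set σ : ℝ → ℝ := fun s => if s ≤ w then (1 : ℝ) else -1 with hσ_def
    have hpw : (|w - c| - |w - (c + ε)|) / ε = forwardMean c ε σ := by
      rw [forwardMean, hσ]; ring
    dsimp only
    have i1 := hii (fun s => |u₁ - s|) (by fun_prop)
    have i2 := hii (fun s => |u₂ - s|) (by fun_prop)
    have i3 := hii _ (hFc κ₁ hκ₁ u₁ hu₁)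
    have i4 := hii _ (hFc κ₂ hκ₂ u₂ hu₂)
    have i5 := hii _ hBc
    have j1 := (i1.add i2).const_mul (1 / 2)
    have j2 := (i4.sub i3).const_mul lam
    have j3 := (i5.mul_const |κ₂ - κ₁|).const_mul lam
    have j4 := hσi.mul_const (a₁ - a₂)
    -- The Kruzhkov and subgradient inequalities hold for each `s`; their mean is taken before
    -- anything is estimated, so no error in `ε` enters the scheme inequality.
    have key : forwardMean c ε (fun s => |w - s|) ≤ forwardMean c ε (fun s =>
        1 / 2 * (|u₁ - s| + |u₂ - s|) - lam * (F κ₂ u₂ s - F κ₁ u₁ s) +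
        lam * (|B s| * |κ₂ - κ₁|) + σ s * (a₁ - a₂)) := by
      refine forwardMean_mono hε (hii (fun s => |w - s|) (by fun_prop))
        (((j1.sub j2).add j3).add j4) fun s hs => ?_
      have h1 := laxFriedrichs_kruzhkov hlam (hLip κ₁ hκ₁) (hLip κ₂ hκ₂) hu₁ hu₂ (hsub hs)
      have h2 := abs_sub_le_subgradient w (1 / 2 * (u₁ + u₂) - lam * (f κ₂ u₂ - f κ₁ u₁)) s
      rw [show w - (1 / 2 * (u₁ + u₂) - lam * (f κ₂ u₂ - f κ₁ u₁)) = a₁ - a₂ by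
        rw [hwe]; ring] at h2
      rw [← hfc κ₁ hκ₁ κ₂ hκ₂ s]
      exact h2.trans (by gcongr)
    rw [forwardMean_add ((j1.sub j2).add j3) j4, forwardMean_add (j1.sub j2) j3,
      forwardMean_sub j1 j2, forwardMean_const_mul, forwardMean_add i1 i2, forwardMean_const_mul,
      forwardMean_sub i4 i3, forwardMean_const_mul, forwardMean_mul_const,
      forwardMean_mul_const] at key
    rw [hpw]
    exact key

/-! ### The variation function of the coefficient -/

/-- The absolute value of the derivative of `k`, cut off outside `[-X, X]`. -/
noncomputable def localSlope (k : ℝ → ℝ) (X : ℝ) : ℝ → ℝ :=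
  (Icc (-X) X).indicator fun x => |deriv k x|

/-- The height of the jump of `k` at `y`. -/
noncomputable def jumpAt (k : ℝ → ℝ) (y : ℝ) : ℝ :=
  Function.rightLim k y - Function.leftLim k y

/-- A distribution function of the total variation of `k` on `[-X, X]`, in which the values of
`k` at its discontinuities play no role. -/
noncomputable def variationFun (k : ℝ → ℝ) (D : Finset ℝ) (X x : ℝ) : ℝ :=
  (∫ t in (0)..x, localSlope k X t) + ∑ y ∈ D, if y ≤ x then |jumpAt k y| else 0

theorem localSlope_nonneg (k : ℝ → ℝ) (X x : ℝ) : 0 ≤ localSlope k X x :=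
  indicator_nonneg (fun _ _ => abs_nonneg _) x

theorem intervalIntegrable_deriv_of_bv {k : ℝ → ℝ} (hk : BoundedVariationOn k univ) (a b : ℝ) :
    IntervalIntegrable (deriv k) volume a b :=
  (hk.mono (subset_univ _)).intervalIntegrable_deriv

theorem integrable_localSlope {k : ℝ → ℝ} (hk : BoundedVariationOn k univ) {X : ℝ} (hX : 0 < X) :
    Integrable (localSlope k X) volume := by
  refine (integrable_indicator_iff measurableSet_Icc).2 ?_
  have := (intervalIntegrable_iff_integrableOn_Icc_of_le (by linarith)).1
    (intervalIntegrable_deriv_of_bv hk (-X) X)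
  exact this.abs

theorem variationFun_mono {k : ℝ → ℝ} (D : Finset ℝ) (hk : BoundedVariationOn k univ) {X : ℝ}
    (hX : 0 < X) : Monotone (variationFun k D X) := by
  intro a b hab
  have hi := integrable_localSlope hk hX
  have h1 := intervalIntegral.integral_add_adjacent_intervals
    (hi.intervalIntegrable (a := 0) (b := a)) (hi.intervalIntegrable (a := a) (b := b))
  have h2 : 0 ≤ ∫ t in a..b, localSlope k X t :=
    intervalIntegral.integral_nonneg hab fun t _ => localSlope_nonneg _ _ _
  refine add_le_add (by linarith) (Finset.sum_le_sum fun y _ => ?_)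
  by_cases h : y ≤ a
  · rw [if_pos h, if_pos (h.trans hab)]
  · rw [if_neg h]
    split_ifs
    exacts [abs_nonneg _, le_rfl]

theorem exists_variationFun_bound {k : ℝ → ℝ} (D : Finset ℝ) (hk : BoundedVariationOn k univ)
    {X : ℝ} (hX : 0 < X) : ∃ M, ∀ x, |variationFun k D X x| ≤ M := by
  have hi := integrable_localSlope hk hX
  refine ⟨(∫ t, localSlope k X t) + ∑ y ∈ D, |jumpAt k y|, fun x => ?_⟩
  refine (abs_add_le _ _).trans (add_le_add ?_ ?_)
  · refine (intervalIntegral.norm_integral_le_integral_norm_uIoc (f := localSlope k X)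
      (μ := volume)).trans ?_
    simp_rw [Real.norm_eq_abs, abs_of_nonneg (localSlope_nonneg k X _)]
    exact setIntegral_le_integral hi (Eventually.of_forall fun t => localSlope_nonneg _ _ _)
  · refine (Finset.abs_sum_le_sum_abs _ _).trans (Finset.sum_le_sum fun y _ => ?_)
    split_ifs
    · rw [abs_abs]
    · rw [abs_zero]; exact abs_nonneg _

/-- `k` with its jumps removed. -/
noncomputable def jumpFree (k : ℝ → ℝ) (D : Finset ℝ) (x : ℝ) : ℝ :=
  Function.leftLim k x - ∑ y ∈ D, if y < x then jumpAt k y else 0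

theorem leftLim_eq_of_notMem {k : ℝ → ℝ} {D : Finset ℝ} (hD : ∀ x, x ∈ D ↔ ¬ ContinuousAt k x)
    {x : ℝ} (hx : x ∉ D) : Function.leftLim k x = k x :=
  (not_not.1 (mt (hD x).2 hx)).continuousWithinAt.leftLim_eq

/-- The function `leftLim k` is left continuous and its right limits are those of `k`, so its only
defect at `x` is `jumpAt k x`. The strict inequality in the jump sum makes that sum left continuous
too, and the two jumps cancel. -/
theorem continuous_jumpFree {k : ℝ → ℝ} {D : Finset ℝ} (hk : BoundedVariationOn k univ)
    (hD : ∀ x, x ∈ D ↔ ¬ ContinuousAt k x) : Continuous (jumpFree k D) := by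
  rw [continuous_iff_continuousAt]
  intro x
  rw [continuousAt_iff_continuous_left'_right']
  constructor
  · have h1 : Tendsto (Function.leftLim k) (𝓝[<] x) (𝓝 (Function.leftLim k x)) :=
      hk.continuousWithinAt_leftLim.mono Iio_subset_Iic_self
    refine h1.sub (tendsto_finsetSum _ fun y _ => ?_)
    refine tendsto_const_nhds.congr' ?_
    by_cases h : y < x
    · filter_upwards [mem_nhdsWithin_of_mem_nhds (Ioi_mem_nhds h)] with z hz
      rw [if_pos h, if_pos (mem_Ioi.1 hz)]
    · filter_upwards [self_mem_nhdsWithin] with z hz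
      rw [if_neg h, if_neg (not_lt.2 (hz.le.trans (not_lt.1 h)))]
  · have hev : ∀ᶠ z in 𝓝[>] x, z ∉ D := by
      have : ((D : Set ℝ) \ {x})ᶜ ∈ 𝓝 x :=
        (D.finite_toSet.subset sdiff_subset).isClosed.isOpen_compl.mem_nhds (by simp)
      filter_upwards [mem_nhdsWithin_of_mem_nhds this, self_mem_nhdsWithin] with z hz hz' hzD
      exact hz ⟨hzD, (ne_of_gt hz' : z ≠ x)⟩
    have h1 : Tendsto (Function.leftLim k) (𝓝[>] x) (𝓝 (Function.rightLim k x)) := by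
      refine (hk.tendsto_rightLim x).congr' ?_
      filter_upwards [hev] with z hz using (leftLim_eq_of_notMem hD hz).symm
    have h2 : Tendsto (fun z => ∑ y ∈ D, if y < z then jumpAt k y else 0) (𝓝[>] x)
        (𝓝 (∑ y ∈ D, if y ≤ x then jumpAt k y else 0)) := by
      refine tendsto_finsetSum _ fun y _ => tendsto_const_nhds.congr' ?_
      by_cases h : y ≤ x
      · filter_upwards [self_mem_nhdsWithin] with z hz
        rw [if_pos h, if_pos (lt_of_le_of_lt h hz)]
      · filter_upwards [mem_nhdsWithin_of_mem_nhds (Iio_mem_nhds (not_le.1 h))] with z hz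
        rw [if_neg h, if_neg (not_lt.2 (le_of_lt hz))]
    have h3 : Function.rightLim k x - (∑ y ∈ D, if y ≤ x then jumpAt k y else 0) =
        jumpFree k D x := by
      have e : ∀ y, (if y ≤ x then jumpAt k y else 0) =
          (if y < x then jumpAt k y else 0) + if y = x then jumpAt k y else 0 := fun y => by
        rcases lt_trichotomy y x with h | h | h
        · simp [h, h.le, h.ne]
        · simp [h]
        · simp [not_le.2 h, not_lt.2 h.le, h.ne']
      simp_rw [e]
      rw [Finset.sum_add_distrib, Finset.sum_ite_eq', jumpFree]
      split_ifs with hx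
      · rw [jumpAt]; ring
      · have hc : ContinuousAt k x := not_not.1 (mt (hD x).2 hx)
        rw [hc.continuousWithinAt.leftLim_eq, hc.continuousWithinAt.rightLim_eq]
        ring
    have := h1.sub h2
    rw [h3] at this
    exact this

/-- Off `P` the function `k` is differentiable, so `D ⊆ P`; near such a point the jump sum is
constant and `leftLim k = k`. -/
theorem hasDerivAt_jumpFree {k : ℝ → ℝ} {D P : Finset ℝ} (hD : ∀ x, x ∈ D ↔ ¬ ContinuousAt k x)
    (hP : ContDiffOn ℝ 1 k ((P : Set ℝ)ᶜ)) {x : ℝ} (hx : x ∉ P) :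
    HasDerivAt (jumpFree k D) (deriv k x) x := by
  have hxn : ((P : Set ℝ)ᶜ) ∈ 𝓝 x := P.finite_toSet.isClosed.isOpen_compl.mem_nhds hx
  have hd : DifferentiableAt ℝ k x :=
    ((hP.differentiableOn (by norm_num)) x hx).differentiableAt hxn
  have hxD : x ∉ D := fun h => (hD x).1 h hd.continuousAt
  have hDn : ((D : Set ℝ)ᶜ) ∈ 𝓝 x := D.finite_toSet.isClosed.isOpen_compl.mem_nhds hxD
  have hs : ∀ᶠ z in 𝓝 x, (∑ y ∈ D, if y < z then jumpAt k y else 0) =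
      ∑ y ∈ D, if y < x then jumpAt k y else 0 := by
    have : ∀ y ∈ D, ∀ᶠ z in 𝓝 x, (if y < z then jumpAt k y else 0) =
        if y < x then jumpAt k y else 0 := fun y hy => by
      have hne : y ≠ x := fun h => hxD (h ▸ hy)
      rcases lt_or_gt_of_ne hne with h | h
      · filter_upwards [Ioi_mem_nhds h] with z hz
        rw [if_pos h, if_pos (mem_Ioi.1 hz)]
      · filter_upwards [Iio_mem_nhds h] with z hz
        rw [if_neg (not_lt.2 h.le), if_neg (not_lt.2 (le_of_lt hz))]
    filter_upwards [(Filter.eventually_all_finset D).2 this] with z hz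
    exact Finset.sum_congr rfl hz
  refine (hd.hasDerivAt.sub_const (∑ y ∈ D, if y < x then jumpAt k y else 0)).congr_of_eventuallyEq
    ?_
  filter_upwards [hs, hDn] with z hz hzD
  rw [jumpFree, hz, leftLim_eq_of_notMem hD hzD]

/-- Away from its discontinuities the increments of `k` are controlled by its variation
function. -/
theorem abs_sub_le_variationFun {k : ℝ → ℝ} {D P : Finset ℝ} (hk : BoundedVariationOn k univ)
    (hD : ∀ x, x ∈ D ↔ ¬ ContinuousAt k x) (hP : ContDiffOn ℝ 1 k ((P : Set ℝ)ᶜ)) {X : ℝ}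
    (hX : 0 < X) {a b : ℝ} (hab : a ≤ b) (ha : a ∉ D) (hb : b ∉ D) (haX : -X ≤ a) (hbX : b ≤ X) :
    |k b - k a| ≤ variationFun k D X b - variationFun k D X a := by
  have hi := integrable_localSlope hk hX
  -- With the jumps removed the function is continuous, so the finite set `P` is no obstacle to the
  -- fundamental theorem.
  have hftc : ∫ t in a..b, deriv k t = jumpFree k D b - jumpFree k D a :=
    integral_eq_of_hasDerivAt_off_countable (jumpFree k D) _ P.countable_toSet
      (continuous_jumpFree hk hD).continuousOn
      (fun x hx => hasDerivAt_jumpFree hD hP (by simpa using hx.2))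
      (intervalIntegrable_deriv_of_bv hk a b)
  have h1 : |jumpFree k D b - jumpFree k D a| ≤ ∫ t in a..b, localSlope k X t := by
    rw [← hftc]
    refine (intervalIntegral.abs_integral_le_integral_abs hab).trans (le_of_eq ?_)
    refine intervalIntegral.integral_congr fun t ht => ?_
    rw [uIcc_of_le hab] at ht
    have htX : t ∈ Icc (-X) X := ⟨haX.trans ht.1, ht.2.trans hbX⟩
    rw [localSlope, indicator_of_mem htX]
  have h2 := intervalIntegral.integral_add_adjacent_intervals
    (hi.intervalIntegrable (a := 0) (b := a)) (hi.intervalIntegrable (a := a) (b := b))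
  have e : k b - k a = (jumpFree k D b - jumpFree k D a) +
      ∑ y ∈ D, ((if y < b then jumpAt k y else 0) - if y < a then jumpAt k y else 0) := by
    rw [jumpFree, jumpFree, leftLim_eq_of_notMem hD ha, leftLim_eq_of_notMem hD hb,
      Finset.sum_sub_distrib]
    ring
  have e' : variationFun k D X b - variationFun k D X a = (∫ t in a..b, localSlope k X t) +
      ∑ y ∈ D, ((if y ≤ b then |jumpAt k y| else 0) - if y ≤ a then |jumpAt k y| else 0) := by
    rw [variationFun, variationFun, ← h2, Finset.sum_sub_distrib]
    ring
  rw [e, e']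
  refine (abs_add_le _ _).trans (add_le_add h1 ?_)
  refine (Finset.abs_sum_le_sum_abs _ _).trans (Finset.sum_le_sum fun y hy => ?_)
  have hya : y ≠ a := fun h => ha (h ▸ hy)
  have hyb : y ≠ b := fun h => hb (h ▸ hy)
  -- As `a` and `b` avoid `D`, the strict inequalities of `jumpFree` and the weak ones of
  -- `variationFun` select the same jumps.
  by_cases h : y < a
  · simp [h, h.le, h.trans_le hab, (h.trans_le hab).le]
  · have h' : ¬ y ≤ a := fun hle => h (lt_of_le_of_ne hle hya)
    by_cases hb' : y < b
    · simp [h, h', hb', hb'.le]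
    · have hb'' : ¬ y ≤ b := fun hle => hb' (lt_of_le_of_ne hle hyb)
      simp [h, h', hb', hb'']

/-- Integration by parts against the variation function. -/
theorem integral_variationFun_mul_deriv {k : ℝ → ℝ} {D : Finset ℝ}
    (hk : BoundedVariationOn k univ) {X : ℝ} (hX : 0 < X) {ψ : ℝ → ℝ} (hψ : ContDiff ℝ 1 ψ)
    (hψX : ∀ x, x ∉ Ioo (-X) X → ψ x = 0) :
    ∫ x, variationFun k D X x * deriv ψ x =
      -((∫ x, localSlope k X x * ψ x) + ∑ y ∈ D, |jumpAt k y| * ψ y) := by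
  have hi := integrable_localSlope hk hX
  have hsupp : Function.support ψ ⊆ Ioo (-X) X := fun x hx => by
    by_contra h
    exact hx (hψX x h)
  have hc : HasCompactSupport ψ :=
    HasCompactSupport.intro (isCompact_Icc (a := -X) (b := X)) fun x hx =>
      hψX x fun h => hx (Ioo_subset_Icc_self h)
  have hdc : Continuous (deriv ψ) := hψ.continuous_deriv le_rfl
  have hdi : Integrable (deriv ψ) volume :=
    hdc.integrable_of_hasCompactSupport hc.deriv
  have hdsupp : ∀ x, x ∉ Ioc (-X) X → deriv ψ x = 0 := fun x hx => by
    have hx' : x ≤ -X ∨ X < x := by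
      by_contra h
      push Not at h
      exact hx ⟨h.1, h.2⟩
    have hev : ∀ z, z < -X ∨ X < z → deriv ψ z = 0 := fun z hz => by
      have : ψ =ᶠ[𝓝 z] fun _ => 0 := by
        rcases hz with h | h
        · filter_upwards [Iio_mem_nhds h] with w hw
          exact hψX w fun h' => absurd h'.1 (not_lt.2 (le_of_lt hw))
        · filter_upwards [Ioi_mem_nhds h] with w hw
          exact hψX w fun h' => absurd h'.2 (not_lt.2 (le_of_lt hw))
      rw [this.deriv_eq, deriv_const]
    rcases hx' with h | h
    -- At the endpoint `-X` itself the derivative vanishes by continuity.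
    · rcases h.eq_or_lt with h | h
      · have hcl : closure (Iio (-X)) ⊆ {z | deriv ψ z = 0} :=
          closure_minimal (fun z hz => hev z (Or.inl hz)) (isClosed_eq hdc continuous_const)
        rw [closure_Iio] at hcl
        exact hcl h.le
      · exact hev x (Or.inl h)
    · exact hev x (Or.inr h)
  -- The primitive of an integrable function: absolutely continuous, which is enough to integrate by
  -- parts although its derivative is known only almost everywhere.
  set W : ℝ → ℝ := fun x => ∫ t in (0)..x, localSlope k X t with hW
  have hWac : AbsolutelyContinuousOnInterval W (-X) X :=
    (hi.intervalIntegrable (a := -X) (b := X)).absolutelyContinuousOnInterval_intervalIntegral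
      (by rw [uIcc_of_le (by linarith)]; constructor <;> linarith)
  have hψac : AbsolutelyContinuousOnInterval ψ (-X) X :=
    hψ.contDiffOn.absolutelyContinuousOnInterval
  have hWd : ∀ᵐ x, deriv W x = localSlope k X x := by
    filter_upwards [LocallyIntegrable.ae_hasDerivAt_integral hi.locallyIntegrable] with x hx using (hx 0).deriv
  have hWint : ∫ x, W x * deriv ψ x = -∫ x, localSlope k X x * ψ x := by
    have h1 : ∫ x, W x * deriv ψ x = ∫ x in (-X)..X, W x * deriv ψ x := by
      rw [intervalIntegral.integral_of_le (by linarith)]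
      exact (setIntegral_eq_integral_of_forall_compl_eq_zero fun x hx => by
        rw [hdsupp x hx, mul_zero]).symm
    have h2 : ∫ x, localSlope k X x * ψ x = ∫ x in (-X)..X, deriv W x * ψ x := by
      rw [intervalIntegral.integral_of_le (by linarith)]
      rw [← setIntegral_eq_integral_of_forall_compl_eq_zero (s := Ioc (-X) X) fun x hx => by
        rw [hψX x fun h => hx (Ioo_subset_Ioc_self h), mul_zero]]
      refine integral_congr_ae (ae_restrict_of_ae ?_)
      filter_upwards [hWd] with x hx
      rw [hx]
    rw [h1, h2, hWac.integral_mul_deriv_eq_deriv_mul hψac, hψX X (by simp),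
      hψX (-X) (by simp)]
    ring
  -- Each jump contributes a Heaviside function, against which `deriv ψ` integrates to `-ψ y`.
  have hJ : ∀ y ∈ D, Integrable (fun x => (if y ≤ x then |jumpAt k y| else 0) * deriv ψ x) ∧
      ∫ x, (if y ≤ x then |jumpAt k y| else 0) * deriv ψ x = -(|jumpAt k y| * ψ y) := by
    intro y _
    have e : (fun x => (if y ≤ x then |jumpAt k y| else 0) * deriv ψ x) =
        (Ici y).indicator fun x => |jumpAt k y| * deriv ψ x := by
      ext x
      by_cases h : y ≤ x
      · simp [h]
      · simp [h]
    rw [e]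
    refine ⟨(hdi.const_mul _).indicator measurableSet_Ici, ?_⟩
    rw [integral_indicator measurableSet_Ici, integral_Ici_eq_integral_Ioi, integral_const_mul,
      hc.integral_Ioi_deriv_eq hψ]
    ring
  have hWi : Integrable (fun x => W x * deriv ψ x) volume := by
    have hWc : Continuous W := intervalIntegral.continuous_primitive
      (fun a b => hi.intervalIntegrable) 0
    exact (hWc.mul hdc).integrable_of_hasCompactSupport hc.deriv.mul_left
  have hsum : ∀ x, variationFun k D X x * deriv ψ x = W x * deriv ψ x +
      ∑ y ∈ D, (if y ≤ x then |jumpAt k y| else 0) * deriv ψ x := fun x => by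
    rw [variationFun, add_mul, Finset.sum_mul]
  simp_rw [hsum]
  rw [integral_add hWi (integrable_finsetSum _ fun y hy => (hJ y hy).1),
    integral_finsetSum _ fun y hy => (hJ y hy).1, hWint,
    Finset.sum_congr rfl fun y hy => (hJ y hy).2, Finset.sum_neg_distrib]
  ring

theorem restrict_halfPlane_eq_prod :
    (volume : Measure (ℝ × ℝ)).restrict {p | 0 ≤ p.2} =
      (volume : Measure ℝ).prod (volume.restrict (Ici 0)) := by
  have : {p : ℝ × ℝ | 0 ≤ p.2} = univ ×ˢ Ici 0 := by ext p; simp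
  rw [this, Measure.volume_eq_prod, ← Measure.prod_restrict, Measure.restrict_univ]

/-- The slope is integrable but possibly unbounded, so the roles are exchanged: `φ` is the bounded
factor, and the slope times a time cutoff is the integrable one. -/
theorem integrableOn_halfPlane_localSlope_mul {k : ℝ → ℝ} (hk : BoundedVariationOn k univ) {X : ℝ}
    (hX : 0 < X) {φ : ℝ × ℝ → ℝ} (hφ : Continuous φ) (hφc : HasCompactSupport φ) :
    IntegrableOn (fun p => localSlope k X p.1 * φ p) {p : ℝ × ℝ | 0 ≤ p.2} := by
  obtain ⟨B, hB⟩ := hφc.exists_bound_of_continuous hφ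
  obtain ⟨R, hR⟩ := hφc.isCompact.isBounded.subset_closedBall (0 : ℝ × ℝ)
  have h1 : Integrable ((Icc (-R) R).indicator fun _ : ℝ => (1 : ℝ)) volume :=
    (integrable_indicator_iff measurableSet_Icc).2 (integrableOn_const (by simp))
  have h2 := ((integrable_localSlope hk hX).mul_prod h1).bdd_mul (f := φ) (c := B)
    hφ.aestronglyMeasurable (Eventually.of_forall hB)
  rw [← Measure.volume_eq_prod] at h2
  refine (h2.congr (Eventually.of_forall fun p => ?_)).integrableOn
  dsimp only
  by_cases hp : p.2 ∈ Icc (-R) R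
  · rw [indicator_of_mem hp]; ring
  · have : φ p = 0 := by
      by_contra h
      have h3 := hR (subset_tsupport _ h)
      rw [mem_closedBall_zero_iff] at h3
      exact hp (abs_le.1 ((norm_snd_le p).trans h3))
    rw [this]; ring

/-- Integration by parts against the variation function on the half plane. -/
theorem setIntegral_variationFun_mul_deriv {k : ℝ → ℝ} {D : Finset ℝ}
    (hk : BoundedVariationOn k univ) {X : ℝ} (hX : 0 < X) {φ : ℝ × ℝ → ℝ}
    (hφ : ContDiff ℝ ∞ φ) (hφc : HasCompactSupport φ) (hφX : ∀ p, φ p ≠ 0 → |p.1| < X) :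
    ∫ p in {p : ℝ × ℝ | 0 ≤ p.2}, variationFun k D X p.1 * deriv (fun x => φ (x, p.2)) p.1 =
      -((∫ p in {p : ℝ × ℝ | 0 ≤ p.2}, |deriv k p.1| * φ p) +
        ∑ y ∈ D, ∫ t in Ici (0 : ℝ), |jumpAt k y| * φ (y, t)) := by
  -- The cutoff at `X` is inactive on the support of `φ`.
  have e1 : ∀ p, |deriv k p.1| * φ p = localSlope k X p.1 * φ p := fun p => by
    by_cases h : φ p = 0
    · rw [h, mul_zero, mul_zero]
    · rw [localSlope, indicator_of_mem (Ioo_subset_Icc_self (abs_lt.1 (hφX p h)))]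
  simp_rw [e1]
  have hgi := integrableOn_halfPlane_localSlope_mul hk hX hφ.continuous hφc
  obtain ⟨M, hM⟩ := exists_variationFun_bound D hk hX
  have hdc : Continuous fun p : ℝ × ℝ => fderiv ℝ φ p (1, 0) :=
    (hφ.continuous_fderiv (by simp)).clm_apply continuous_const
  have hdcs : HasCompactSupport fun p : ℝ × ℝ => fderiv ℝ φ p (1, 0) := hφc.fderiv_apply ℝ _
  have hVi : IntegrableOn (fun p : ℝ × ℝ => variationFun k D X p.1 *
      deriv (fun x => φ (x, p.2)) p.1) {p : ℝ × ℝ | 0 ≤ p.2} := by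
    have := integrable_bdd_mul_of_compactSupport (g := fun p => variationFun k D X p.1)
      ((variationFun_mono D hk hX).measurable.comp measurable_fst) (fun p => hM p.1) hdc hdcs
    refine (this.congr (Eventually.of_forall fun p => ?_)).integrableOn
    dsimp only
    rw [deriv_fst_eq_fderiv hφ]
  have hJi : ∀ y ∈ D, Integrable (fun t => |jumpAt k y| * φ (y, t)) (volume.restrict (Ici 0)) := by
    intro y _
    have hc : HasCompactSupport fun t => φ (y, t) := by
      obtain ⟨R, hR⟩ := hφc.isCompact.isBounded.subset_closedBall (0 : ℝ × ℝ)
      refine HasCompactSupport.intro (isCompact_Icc (a := -R) (b := R)) fun t ht => ?_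
      by_contra h
      have h3 := hR (subset_tsupport _ h)
      rw [mem_closedBall_zero_iff] at h3
      exact ht (abs_le.1 ((norm_snd_le (y, t)).trans h3))
    have hcont : Continuous fun t => φ (y, t) := hφ.continuous.comp (by fun_prop)
    exact ((hcont.integrable_of_hasCompactSupport hc).const_mul _).integrableOn
  unfold IntegrableOn at hgi hVi
  rw [restrict_halfPlane_eq_prod] at hgi hVi ⊢
  rw [integral_prod_symm _ hgi, integral_prod_symm _ hVi, ← integral_finsetSum _ hJi,
    ← integral_add hgi.integral_prod_right (integrable_finsetSum _ hJi), ← integral_neg]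
  refine integral_congr_ae (Eventually.of_forall fun t => ?_)
  have hψ : ContDiff ℝ 1 fun x => φ (x, t) :=
    (hφ.of_le (by simp)).comp (contDiff_id.prodMk contDiff_const)
  have := integral_variationFun_mul_deriv (D := D) hk hX hψ fun x hx => by
    by_contra h
    exact hx (abs_lt.1 (hφX (x, t) h))
  exact this

/-! ### The cubic estimate and the corrections -/

/-- If `y ≥ τ` then `y ≤ y * (y / τ) ^ 2`. This trades the first power of a jump for the cube that
the scheme controls. -/
theorem le_add_cube_div_sq {y τ : ℝ} (hy : 0 ≤ y) (hτ : 0 < τ) : y ≤ τ + y ^ 3 / τ ^ 2 := by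
  rcases le_total y τ with h | h
  · have : 0 ≤ y ^ 3 / τ ^ 2 := by positivity
    linarith
  · have : y ≤ y ^ 3 / τ ^ 2 := by
      rw [le_div_iff₀ (by positivity)]
      nlinarith [mul_le_mul_of_nonneg_left (pow_le_pow_left₀ hτ.le h 2) hy]
    linarith

/-- The part of the plane on which the stencil over the cell `i` at level `n` is used. -/
def stencilCell (dx dt : ℝ) (n : ℕ) (i : ℤ) : Set (ℝ × ℝ) :=
  Ico ((i : ℝ) * dx / 2) (((i : ℝ) + 2) * dx / 2) ×ˢ Ico (n * dt - dt) (n * dt)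

theorem measurableSet_stencilCell (dx dt : ℝ) (n : ℕ) (i : ℤ) :
    MeasurableSet (stencilCell dx dt n i) := measurableSet_Ico.prod measurableSet_Ico

theorem volume_real_stencilCell {dx dt : ℝ} (hdx : 0 < dx) (hdt : 0 < dt) (n : ℕ) (i : ℤ) :
    (volume : Measure (ℝ × ℝ)).real (stencilCell dx dt n i) = dx * dt := by
  rw [stencilCell, Measure.volume_eq_prod, measureReal_prod_prod,
    Real.volume_real_Ico_of_le (by nlinarith), Real.volume_real_Ico_of_le (by linarith)]
  ring

theorem volume_stencilCell_ne_top (dx dt : ℝ) (n : ℕ) (i : ℤ) :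
    (volume : Measure (ℝ × ℝ)) (stencilCell dx dt n i) ≠ ⊤ := by
  rw [stencilCell, Measure.volume_eq_prod, Measure.prod_prod]
  exact ENNReal.mul_ne_top (by simp) (by simp)

/-- The jump of the approximate solution across the stencil, at the new time level. -/
noncomputable def stencilJump (dx dt : ℝ) (U : ℕ → ℤ → ℝ) (q : ℝ × ℝ) : ℝ :=
  gridFun dx dt U (q + (dx / 2, dt)) - gridFun dx dt U (q + (-(dx / 2), dt))

theorem measurable_stencilJump (dx dt : ℝ) (U : ℕ → ℤ → ℝ) :
    Measurable (stencilJump dx dt U) :=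
  ((measurable_gridFun dx dt U).comp (measurable_add_const _)).sub
    ((measurable_gridFun dx dt U).comp (measurable_add_const _))

/-- The point `q` lies in the stencil cell of one pair `(n, i)` that occurs in the sum, and the
other terms are nonnegative; disjointness of the cells is not needed. The enlargements `R + 1` and
`R + lam` pay for the shifts by one cell and one time step. -/
theorem abs_stencilJump_cube_le {dx lam R : ℝ} (hdx : 0 < dx) (hdx1 : dx ≤ 1) (hlam : 0 < lam)
    (U : ℕ → ℤ → ℝ) {q : ℝ × ℝ} (hq0 : 0 ≤ q.2) (hq : ‖q‖ ≤ R) :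
    |stencilJump dx (lam * dx) U q| ^ 3 ≤
      ∑ n ∈ Finset.range (⌊(R + lam) / (lam * dx)⌋₊ + 1),
        ∑ i ∈ (Finset.Icc (-(2 * (⌊(R + 1) / dx⌋ + 1))) (2 * (⌊(R + 1) / dx⌋ + 1))).filter
          (fun i : ℤ => Even (i + (n : ℤ))),
          (stencilCell dx (lam * dx) n i).indicator (fun _ => |U n (i + 2) - U n i| ^ 3) q := by
  set dt := lam * dx with hdt
  have hdt0 : 0 < dt := mul_pos hlam hdx
  obtain ⟨x, t⟩ := q
  have hx : |x| ≤ R := (norm_fst_le (x, t)).trans hq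
  have ht : |t| ≤ R := (norm_snd_le (x, t)).trans hq
  replace hq0 : 0 ≤ t := hq0
  obtain ⟨hx1, hx2⟩ := abs_le.1 hx
  set n := ⌊t / dt⌋₊ + 1 with hn
  set i := gridIndex dx n (x - dx / 2) with hi
  have hi2 : gridIndex dx n (x + dx / 2) = i + 2 := by
    rw [hi, gridIndex_add_half hdx, gridIndex_sub_half hdx]; ring
  have hjump : stencilJump dx dt U (x, t) = U n (i + 2) - U n i := by
    simp only [stencilJump, gridFun, Prod.mk_add_mk]
    rw [floor_add_div_self hdt0 hq0, ← hn, hi2, ← sub_eq_add_neg]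
  have hb1 := gridIndex_le hdx n (x - dx / 2)
  have hb2 := lt_gridIndex hdx n (x - dx / 2)
  rw [← hi] at hb1 hb2
  have hnt : (n : ℝ) * dt ≤ t + dt := by
    have h1 := Nat.floor_le (div_nonneg hq0 hdt0.le)
    rw [le_div_iff₀ hdt0] at h1
    rw [hn]; push_cast; linarith
  have hnt' : t < n * dt := by
    have h1 := Nat.lt_floor_add_one (t / dt)
    rw [div_lt_iff₀ hdt0] at h1
    rw [hn]; push_cast; linarith
  have hmem : (x, t) ∈ stencilCell dx dt n i := by
    refine ⟨⟨?_, ?_⟩, ⟨?_, ?_⟩⟩ <;> dsimp only <;> linarith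
  have hnN : n ∈ Finset.range (⌊(R + lam) / dt⌋₊ + 1) := by
    rw [Finset.mem_range, Nat.lt_succ_iff]
    refine Nat.le_floor ?_
    rw [le_div_iff₀ hdt0]
    have := le_abs_self t
    nlinarith
  have hJ := Int.lt_floor_add_one ((R + 1) / dx)
  set J := ⌊(R + 1) / dx⌋ + 1 with hJ_def
  have hJ' : R + 1 < (J : ℝ) * dx := by
    rw [div_lt_iff₀ hdx] at hJ
    rw [hJ_def]; push_cast; linarith
  have hiJ : i ∈ (Finset.Icc (-(2 * J)) (2 * J)).filter (fun i : ℤ => Even (i + (n : ℤ))) := by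
    rw [Finset.mem_filter, Finset.mem_Icc]
    refine ⟨⟨?_, ?_⟩, even_gridIndex_add _ _ _⟩
    · have : (-(2 * J) : ℝ) ≤ i := by
        by_contra h
        have := mul_lt_mul_of_pos_right (not_le.1 h) hdx
        nlinarith
      exact_mod_cast this
    · have : (i : ℝ) ≤ 2 * J := by
        by_contra h
        have := mul_lt_mul_of_pos_right (not_le.1 h) hdx
        nlinarith
      exact_mod_cast this
  rw [hjump]
  have hnn : ∀ (n : ℕ) (i : ℤ), 0 ≤ (stencilCell dx dt n i).indicator
      (fun _ => |U n (i + 2) - U n i| ^ 3) (x, t) := fun n i =>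
    indicator_nonneg (fun _ _ => by positivity) _
  calc |U n (i + 2) - U n i| ^ 3 = (stencilCell dx dt n i).indicator
        (fun _ => |U n (i + 2) - U n i| ^ 3) (x, t) := by rw [indicator_of_mem hmem]
    _ ≤ ∑ i ∈ (Finset.Icc (-(2 * J)) (2 * J)).filter (fun i : ℤ => Even (i + (n : ℤ))),
          (stencilCell dx dt n i).indicator (fun _ => |U n (i + 2) - U n i| ^ 3) (x, t) :=
        Finset.single_le_sum (f := fun i => (stencilCell dx dt n i).indicator
          (fun _ => |U n (i + 2) - U n i| ^ 3) (x, t)) (fun i _ => hnn n i) hiJ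
    _ ≤ _ := Finset.single_le_sum (f := fun n : ℕ => ∑ i ∈ (Finset.Icc (-(2 * J)) (2 * J)).filter
          (fun i : ℤ => Even (i + (n : ℤ))), (stencilCell dx dt n i).indicator
          (fun _ => |U n (i + 2) - U n i| ^ 3) (x, t))
          (fun n _ => Finset.sum_nonneg fun i _ => hnn n i) hnN

/-- The cubic estimate controls the space-time integral of the cubed jumps. -/
theorem setIntegral_stencilJump_cube_le {dx lam R M : ℝ} (hdx : 0 < dx) (hdx1 : dx ≤ 1)
    (hlam : 0 < lam) {U : ℕ → ℤ → ℝ} (hM : ∀ q, |stencilJump dx (lam * dx) U q| ≤ M) :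
    ∫ q in {q : ℝ × ℝ | 0 ≤ q.2} ∩ Metric.closedBall 0 R,
      |stencilJump dx (lam * dx) U q| ^ 3 ≤
      lam * dx * cubicSum dx (lam * dx) U (R + 1) (R + lam) := by
  have hdt0 : 0 < lam * dx := mul_pos hlam hdx
  have hSm : MeasurableSet ({q : ℝ × ℝ | 0 ≤ q.2} ∩ Metric.closedBall 0 R) :=
    (measurableSet_le measurable_const measurable_snd).inter measurableSet_closedBall
  have hSv : volume ({q : ℝ × ℝ | 0 ≤ q.2} ∩ Metric.closedBall 0 R) ≠ ⊤ :=
    ((measure_mono inter_subset_right).trans_lt measure_closedBall_lt_top).ne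
  have hi : ∀ (n : ℕ) (i : ℤ), Integrable ((stencilCell dx (lam * dx) n i).indicator
      (fun _ => |U n (i + 2) - U n i| ^ 3)) volume := fun n i =>
    (integrable_indicator_iff (measurableSet_stencilCell _ _ _ _)).2
      (integrableOn_const (volume_stencilCell_ne_top _ _ _ _))
  have hint : ∀ (n : ℕ) (i : ℤ), ∫ q, (stencilCell dx (lam * dx) n i).indicator
      (fun _ => |U n (i + 2) - U n i| ^ 3) q = dx * (lam * dx) * |U n (i + 2) - U n i| ^ 3 :=
    fun n i => by
      rw [integral_indicator (measurableSet_stencilCell _ _ _ _), setIntegral_const,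
        volume_real_stencilCell hdx hdt0, smul_eq_mul]
  set G : ℝ × ℝ → ℝ := fun q => ∑ n ∈ Finset.range (⌊(R + lam) / (lam * dx)⌋₊ + 1),
        ∑ i ∈ (Finset.Icc (-(2 * (⌊(R + 1) / dx⌋ + 1))) (2 * (⌊(R + 1) / dx⌋ + 1))).filter
          (fun i : ℤ => Even (i + (n : ℤ))),
          (stencilCell dx (lam * dx) n i).indicator (fun _ => |U n (i + 2) - U n i| ^ 3) q
    with hG
  have hGi : Integrable G volume :=
    integrable_finsetSum _ fun n _ => integrable_finsetSum _ fun i _ => hi n i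
  have hG0 : ∀ q, 0 ≤ G q := fun q => Finset.sum_nonneg fun n _ => Finset.sum_nonneg fun i _ =>
    indicator_nonneg (fun _ _ => by positivity) _
  calc ∫ q in {q : ℝ × ℝ | 0 ≤ q.2} ∩ Metric.closedBall 0 R, |stencilJump dx (lam * dx) U q| ^ 3
      ≤ ∫ q in {q : ℝ × ℝ | 0 ≤ q.2} ∩ Metric.closedBall 0 R, G q := by
        refine setIntegral_mono_on ?_ hGi.integrableOn hSm fun q hq => ?_
        · refine Measure.integrableOn_of_bounded (M := M ^ 3) hSv ?_ ?_
          · exact ((measurable_stencilJump _ _ _).norm.pow_const 3).aestronglyMeasurable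
          · refine Eventually.of_forall fun q => ?_
            rw [norm_pow, Real.norm_eq_abs, abs_abs]
            exact pow_le_pow_left₀ (abs_nonneg _) (hM q) 3
        · exact abs_stencilJump_cube_le hdx hdx1 hlam U hq.1 (mem_closedBall_zero_iff.1 hq.2)
    _ ≤ ∫ q, G q := setIntegral_le_integral hGi (Eventually.of_forall hG0)
    _ = lam * dx * cubicSum dx (lam * dx) U (R + 1) (R + lam) := by
        rw [hG, integral_finsetSum _ fun n _ => integrable_finsetSum _ fun i _ => hi n i]
        simp_rw [integral_finsetSum _ fun i _ => hi _ i, hint]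
        rw [cubicSum, Finset.mul_sum, Finset.mul_sum]
        refine Finset.sum_congr rfl fun n _ => ?_
        rw [Finset.mul_sum, Finset.mul_sum]
        refine Finset.sum_congr rfl fun i _ => ?_
        ring

/-- The contribution of the corrections to the weak entropy inequality. -/
theorem exists_corrector_bound {φ : ℝ × ℝ → ℝ} (hφ : ContDiff ℝ ∞ φ) (hφc : HasCompactSupport φ)
    {lam : ℝ} (hlam : 0 < lam) :
    ∃ C R : ℝ, 0 ≤ C ∧ 0 < R ∧ ∀ dx : ℝ, 0 < dx → dx ≤ 1 →
      ∀ (U a : ℕ → ℤ → ℝ) (p : ℝ → ℝ) (A l N M τ : ℝ), 0 < τ → 0 ≤ l → Measurable p →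
      (∀ v, |p v| ≤ 1) → (∀ v w, |p v - p w| ≤ l * |v - w|) →
      (∀ q, |gridFun dx (lam * dx) U q| ≤ M) →
      (∀ q, |gridFun dx (lam * dx) a q| ≤ A) →
      cubicSum dx (lam * dx) U (R + 1) (R + lam) ≤ N →
      (1 / (lam * dx)) * ∫ q in {q : ℝ × ℝ | 0 ≤ q.2},
        (p (gridFun dx (lam * dx) U (q + (0, lam * dx))) *
          (gridFun dx (lam * dx) a (q + (-(dx / 2), 0)) -
            gridFun dx (lam * dx) a (q + (dx / 2, 0)))) * φ (q + (0, lam * dx)) ≤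
        C * (A / dx) * (l * (τ + dx * N / τ ^ 2) + dx) := by
  obtain ⟨L, R, hL, hR, hφL, hlip, -, hsupp, -⟩ := exists_testFunction_bounds hφ hφc hlam
  set V := (volume : Measure (ℝ × ℝ)).real (Metric.closedBall 0 R) with hV
  have hV0 : 0 ≤ V := measureReal_nonneg
  -- The volume `V` comes from integrating constants over the ball, and `lam` from `dt = lam * dx`.
  -- Multiplying out creates only additional nonnegative cross terms, which are dropped at the end.
  refine ⟨(L * V + L * lam) / lam, R, by positivity, hR, ?_⟩
  intro dx hdx hdx1 U a p A l N M τ hτ hl hpm hp1 hpl hUM haA hN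
  set dt := lam * dx with hdt
  have hdt0 : 0 < dt := mul_pos hlam hdx
  set S : Set (ℝ × ℝ) := {q | 0 ≤ q.2} with hS
  have hSm : MeasurableSet S := measurableSet_le measurable_const measurable_snd
  set u := gridFun dx dt U with hu
  set b := gridFun dx dt a with hb
  have hum : Measurable u := measurable_gridFun _ _ _
  have hbm : Measurable b := measurable_gridFun _ _ _
  have hA0 : 0 ≤ A := (abs_nonneg _).trans (haA 0)
  have hJM : ∀ q, |stencilJump dx dt U q| ≤ M + M := fun q =>
    (abs_sub _ _).trans (add_le_add (hUM _) (hUM _))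
  have hI : ∀ v w z : ℝ × ℝ, Integrable (fun q => b (q + v) * p (u (q + w)) * φ (q + z)) volume :=
    fun v w z => by
      refine integrable_bdd_mul_of_compactSupport (M := A)
        ((hbm.comp (measurable_add_const v)).mul (hpm.comp (hum.comp (measurable_add_const w))))
        (fun q => ?_) (hφ.continuous.comp (continuous_id.add continuous_const))
        (hasCompactSupport_comp_add_right hφc z)
      rw [abs_mul]
      have := mul_le_mul (haA (q + v)) (hp1 (u (q + w))) (abs_nonneg _) hA0
      rwa [mul_one] at this
  have hT : ∀ s : ℝ, ∫ q in S, b (q + (-s, 0)) * p (u (q + (0, dt))) * φ (q + (0, dt)) =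
      ∫ q in S, b q * p (u (q + (s, dt))) * φ (q + (s, dt)) := fun s => by
    have := setIntegral_halfPlane_translate
      (fun q => b q * p (u (q + (s, dt))) * φ (q + (s, dt))) (-s) 0 0
    rw [add_zero] at this
    rw [← this]
    refine integral_congr_ae (Eventually.of_forall fun q => ?_)
    have e : q + (-s, 0) + (s, dt) = q + (0, dt) := by ext <;> simp
    dsimp only
    rw [e]
  -- The difference passes from the corrections, of which only the size is known, to the product of
  -- `p (u)` and `φ`.
  have h1 : ∫ q in S, (p (u (q + (0, dt))) * (b (q + (-(dx / 2), 0)) - b (q + (dx / 2, 0)))) *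
      φ (q + (0, dt)) = ∫ q in S, (b q * p (u (q + (dx / 2, dt))) * φ (q + (dx / 2, dt)) -
        b q * p (u (q + (-(dx / 2), dt))) * φ (q + (-(dx / 2), dt))) := by
    have t1 := hT (dx / 2)
    have t2 := hT (-(dx / 2))
    rw [neg_neg] at t2
    have i1 := (hI 0 (dx / 2, dt) (dx / 2, dt)).integrableOn (s := S)
    have i2 := (hI 0 (-(dx / 2), dt) (-(dx / 2), dt)).integrableOn (s := S)
    simp only [add_zero] at i1 i2
    rw [integral_sub i1 i2, ← t1, ← t2, ← integral_sub (hI _ _ _).integrableOn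
      (hI _ _ _).integrableOn]
    refine integral_congr_ae (Eventually.of_forall fun q => ?_)
    dsimp only
    ring
  have hptw : ∀ q ∈ S, b q * p (u (q + (dx / 2, dt))) * φ (q + (dx / 2, dt)) -
        b q * p (u (q + (-(dx / 2), dt))) * φ (q + (-(dx / 2), dt)) ≤
      (Metric.closedBall (0 : ℝ × ℝ) R).indicator (fun q => A * (l * L * (τ +
        |stencilJump dx dt U q| ^ 3 / τ ^ 2) + L * dx)) q := by
    intro q _
    have hvn : ∀ s : ℝ, |s| = dx / 2 → ‖((s, dt) : ℝ × ℝ)‖ ≤ (1 + lam) * dx := fun s hs => by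
      rw [Prod.norm_def]
      simp only [Real.norm_eq_abs, hs, abs_of_pos hdt0]
      refine max_le ?_ ?_ <;> nlinarith
    by_cases hq : q ∈ Metric.closedBall (0 : ℝ × ℝ) R
    · rw [indicator_of_mem hq]
      -- Discrete product rule: the jump of `p (u)` is bounded through the jump of `u`, and the
      -- increment of `φ` is `O(dx)`.
      have e : b q * p (u (q + (dx / 2, dt))) * φ (q + (dx / 2, dt)) -
          b q * p (u (q + (-(dx / 2), dt))) * φ (q + (-(dx / 2), dt)) =
          b q * ((p (u (q + (dx / 2, dt))) - p (u (q + (-(dx / 2), dt)))) * φ (q + (dx / 2, dt)) +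
          p (u (q + (-(dx / 2), dt))) * (φ (q + (dx / 2, dt)) - φ (q + (-(dx / 2), dt)))) := by
        ring
      rw [e]
      refine (le_abs_self _).trans ?_
      rw [abs_mul]
      refine mul_le_mul (haA q) ((abs_add_le _ _).trans ?_) (abs_nonneg _) hA0
      rw [abs_mul, abs_mul]
      refine add_le_add ?_ ?_
      · have y1 := le_add_cube_div_sq (abs_nonneg (stencilJump dx dt U q)) hτ
        have y2 := hpl (u (q + (dx / 2, dt))) (u (q + (-(dx / 2), dt)))
        have y3 : |p (u (q + (dx / 2, dt))) - p (u (q + (-(dx / 2), dt)))| ≤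
            l * (τ + |stencilJump dx dt U q| ^ 3 / τ ^ 2) :=
          y2.trans (mul_le_mul_of_nonneg_left y1 hl)
        have := mul_le_mul y3 (hφL (q + (dx / 2, dt))) (abs_nonneg _)
          ((abs_nonneg _).trans y3)
        linarith
      · have y1 := hlip (q + (dx / 2, dt)) (q + (-(dx / 2), dt))
        have y2 : ‖q + (dx / 2, dt) - (q + (-(dx / 2), dt))‖ = dx := by
          rw [add_sub_add_left_eq_sub, Prod.mk_sub_mk, sub_self, sub_neg_eq_add, add_halves,
            Prod.norm_def]
          simp [abs_of_pos hdx, hdx.le]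
        rw [y2] at y1
        have := mul_le_mul (hp1 (u (q + (-(dx / 2), dt)))) y1 (abs_nonneg _) zero_le_one
        linarith
    · rw [indicator_of_notMem hq]
      have hq' : ¬ ‖q‖ ≤ R := by simpa using hq
      have z1 : φ (q + (dx / 2, dt)) = 0 := by
        by_contra h
        exact hq' (hsupp dx hdx hdx1 q _ (hvn _ (abs_of_pos (by linarith))) h)
      have z2 : φ (q + (-(dx / 2), dt)) = 0 := by
        by_contra h
        exact hq' (hsupp dx hdx hdx1 q _ (hvn _ (by rw [abs_neg, abs_of_pos (by linarith)])) h)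
      rw [z1, z2]; simp
  have hJ3 : IntegrableOn (fun q => |stencilJump dx dt U q| ^ 3)
      (S ∩ Metric.closedBall 0 R) volume := by
    refine Measure.integrableOn_of_bounded (M := (M + M) ^ 3)
      ((measure_mono inter_subset_right).trans_lt measure_closedBall_lt_top).ne ?_ ?_
    · exact ((measurable_stencilJump _ _ _).norm.pow_const 3).aestronglyMeasurable
    · refine Eventually.of_forall fun q => ?_
      rw [norm_pow, Real.norm_eq_abs, abs_abs]
      exact pow_le_pow_left₀ (abs_nonneg _) (hJM q) 3
  have hc : ∀ c : ℝ, IntegrableOn (fun _ : ℝ × ℝ => c) (S ∩ Metric.closedBall 0 R) volume :=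
    fun c => integrableOn_const
      ((measure_mono inter_subset_right).trans_lt measure_closedBall_lt_top).ne
  have hbound : IntegrableOn (fun q => A * (l * L * (τ +
        |stencilJump dx dt U q| ^ 3 / τ ^ 2) + L * dx)) (S ∩ Metric.closedBall 0 R) volume :=
    ((((hc τ).add (hJ3.div_const (τ ^ 2))).const_mul (l * L)).add (hc (L * dx))).const_mul A
  have hSV : (volume : Measure (ℝ × ℝ)).real (S ∩ Metric.closedBall 0 R) ≤ V :=
    measureReal_mono inter_subset_right measure_closedBall_lt_top.ne
  have h2 : ∫ q in S, (b q * p (u (q + (dx / 2, dt))) * φ (q + (dx / 2, dt)) -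
        b q * p (u (q + (-(dx / 2), dt))) * φ (q + (-(dx / 2), dt))) ≤
      A * (l * L * (τ * V + dt * N / τ ^ 2) + L * dx * V) := by
    calc _ ≤ ∫ q in S, (Metric.closedBall (0 : ℝ × ℝ) R).indicator (fun q => A * (l * L * (τ +
        |stencilJump dx dt U q| ^ 3 / τ ^ 2) + L * dx)) q := by
          refine setIntegral_mono_on ?_ ?_ hSm hptw
          · have i1 := (hI 0 (dx / 2, dt) (dx / 2, dt)).integrableOn (s := S)
            have i2 := (hI 0 (-(dx / 2), dt) (-(dx / 2), dt)).integrableOn (s := S)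
            simp only [add_zero] at i1 i2
            exact i1.sub i2
          · rw [IntegrableOn, integrable_indicator_iff measurableSet_closedBall, IntegrableOn,
              Measure.restrict_restrict measurableSet_closedBall, inter_comm]
            exact hbound
      _ = ∫ q in S ∩ Metric.closedBall 0 R, A * (l * L * (τ +
        |stencilJump dx dt U q| ^ 3 / τ ^ 2) + L * dx) := by
          rw [setIntegral_indicator measurableSet_closedBall]
      _ = A * (l * L * (τ * volume.real (S ∩ Metric.closedBall 0 R) +
          (∫ q in S ∩ Metric.closedBall 0 R, |stencilJump dx dt U q| ^ 3) / τ ^ 2) +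
          L * dx * volume.real (S ∩ Metric.closedBall 0 R)) := by
          have j1 : IntegrableOn (fun q => τ + |stencilJump dx dt U q| ^ 3 / τ ^ 2)
            (S ∩ Metric.closedBall 0 R) volume := (hc τ).add (hJ3.div_const (τ ^ 2))
          rw [integral_const_mul, integral_add (j1.const_mul _) (hc _), integral_const_mul,
            integral_add (hc τ) (hJ3.div_const _), integral_div, setIntegral_const,
            setIntegral_const, smul_eq_mul, smul_eq_mul]
          ring
      _ ≤ _ := by
          have h3 := setIntegral_stencilJump_cube_le (R := R) hdx hdx1 hlam hJM
          have h4 := h3.trans (mul_le_mul_of_nonneg_left hN hdt0.le)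
          gcongr
  rw [h1, one_div, inv_mul_le_iff₀ hdt0]
  refine h2.trans ?_
  have hN0 : 0 ≤ N := by
    refine le_trans ?_ hN
    unfold cubicSum
    positivity
  have e : dt * ((L * V + L * lam) / lam * (A / dx) * (l * (τ + dx * N / τ ^ 2) + dx)) =
      A * (l * L * (τ * V + dt * N / τ ^ 2) + L * dx * V) +
      A * (l * L * (lam * τ + V * dx * N / τ ^ 2) + L * lam * dx) := by
    rw [hdt]
    field_simp
    ring
  rw [e]
  have : 0 ≤ A * (l * L * (lam * τ + V * dx * N / τ ^ 2) + L * lam * dx) := by positivity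
  linarith

/-! ### From grid to points: stencils, one-sided limits and rates -/

theorem gridFun_stencil {dx dt : ℝ} (hdx : 0 < dx) (hdt : 0 < dt) {q : ℝ × ℝ} (hq : 0 ≤ q.2) :
    ∃ (n : ℕ) (i : ℤ), Even (i + (n : ℤ)) ∧ ((i : ℝ) - 1) * dx / 2 ≤ q.1 - dx / 2 ∧
      q.1 - dx / 2 < ((i : ℝ) + 1) * dx / 2 ∧ ∀ g : ℕ → ℤ → ℝ,
        gridFun dx dt g (q + (-(dx / 2), 0)) = g n i ∧
        gridFun dx dt g (q + (dx / 2, 0)) = g n (i + 2) ∧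
        gridFun dx dt g (q + (0, dt)) = g (n + 1) (i + 1) := by
  obtain ⟨x, t⟩ := q
  replace hq : 0 ≤ t := hq
  have e1 : gridIndex dx ⌊t / dt⌋₊ (x + dx / 2) = gridIndex dx ⌊t / dt⌋₊ (x - dx / 2) + 2 := by
    rw [gridIndex_add_half hdx, gridIndex_sub_half hdx]; ring
  have e2 : gridIndex dx (⌊t / dt⌋₊ + 1) x = gridIndex dx ⌊t / dt⌋₊ (x - dx / 2) + 1 := by
    rw [gridIndex_sub_half hdx]; ring
  refine ⟨⌊t / dt⌋₊, gridIndex dx ⌊t / dt⌋₊ (x - dx / 2), even_gridIndex_add _ _ _,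
    gridIndex_le hdx _ _, lt_gridIndex hdx _ _, fun g => ⟨?_, ?_, ?_⟩⟩
  · simp only [gridFun, Prod.mk_add_mk, add_zero, ← sub_eq_add_neg]
  · simp only [gridFun, Prod.mk_add_mk, add_zero, e1]
  · simp only [gridFun, Prod.mk_add_mk, add_zero]
    rw [floor_add_div_self hdt hq, e2]

theorem exists_mem_Ioo_of_ae {k : ℝ → ℝ} {A : Set ℝ} (hk : ∀ᵐ x : ℝ, k x ∈ A) {a b : ℝ}
    (hab : a < b) : ∃ z ∈ Ioo a b, k z ∈ A := by
  by_contra h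
  push Not at h
  have h1 : volume (Ioo a b) = 0 :=
    measure_mono_null (fun z hz => h z hz) (ae_iff.1 hk)
  rw [Real.volume_Ioo, ENNReal.ofReal_eq_zero] at h1
  linarith

/-- A set of full measure is dense, and `A` is closed. Values of `k` at single points may leave
`[kl, ku]`, where nothing is known of `f`; one-sided limits cannot. -/
theorem leftLim_mem_of_ae {k : ℝ → ℝ} {A : Set ℝ} (hA : IsClosed A) (hk : ∀ᵐ x : ℝ, k x ∈ A)
    (hbv : BoundedVariationOn k univ) (x : ℝ) : Function.leftLim k x ∈ A := by
  refine hA.mem_of_frequently_of_tendsto (frequently_iff.2 fun {W} hW => ?_)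
    (hbv.tendsto_leftLim x)
  obtain ⟨a, ha, haW⟩ := (mem_nhdsLT_iff_exists_Ioo_subset).1 hW
  obtain ⟨z, hz, hzA⟩ := exists_mem_Ioo_of_ae hk ha
  exact ⟨z, haW hz, hzA⟩

theorem rightLim_mem_of_ae {k : ℝ → ℝ} {A : Set ℝ} (hA : IsClosed A) (hk : ∀ᵐ x : ℝ, k x ∈ A)
    (hbv : BoundedVariationOn k univ) (x : ℝ) : Function.rightLim k x ∈ A := by
  refine hA.mem_of_frequently_of_tendsto (frequently_iff.2 fun {W} hW => ?_)
    (hbv.tendsto_rightLim x)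
  obtain ⟨a, ha, haW⟩ := (mem_nhdsGT_iff_exists_Ioo_subset).1 hW
  obtain ⟨z, hz, hzA⟩ := exists_mem_Ioo_of_ae hk ha
  exact ⟨z, haW hz, hzA⟩

theorem measurable_of_bv {k : ℝ → ℝ} (hk : BoundedVariationOn k univ) : Measurable k := by
  obtain ⟨p, q, hp, hq, rfl⟩ := hk.locallyBoundedVariationOn.exists_monotoneOn_sub_monotoneOn
  exact (monotoneOn_univ.1 hp).measurable.sub (monotoneOn_univ.1 hq).measurable

/-- The Kruzhkov flux attached to a Lipschitz function is continuous in the state, for every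
value of the Kruzhkov parameter. -/
theorem continuousOn_sign_mul_sub {g : ℝ → ℝ} {ul uu l : ℝ}
    (hg : ∀ v ∈ Icc ul uu, ∀ w ∈ Icc ul uu, |g v - g w| ≤ l * |v - w|) (c : ℝ) :
    ContinuousOn (fun v => Real.sign (v - c) * (g v - g c)) (Icc ul uu) := by
  have hgc : ContinuousOn g (Icc ul uu) := continuousOn_of_abs_sub_le hg
  by_cases hc : c ∈ Icc ul uu
  · simp_rw [sign_mul_sub_eq]
    exact (hgc.comp (by fun_prop) fun v hv => max_mem_Icc' hv hc).sub
      (hgc.comp (by fun_prop) fun v hv => min_mem_Icc' hv hc)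
  -- Outside the interval no Lipschitz bound relates `g c` to the other values, but there the sign
  -- is constant.
  · rcases lt_or_ge c ul with h | h
    · refine (continuousOn_const.mul (hgc.sub continuousOn_const) :
        ContinuousOn (fun v => (1 : ℝ) * (g v - g c)) _).congr fun v hv => ?_
      rw [Real.sign_of_pos (by linarith [hv.1])]; rfl
    · have h' : uu < c := not_le.1 fun h' => hc ⟨h, h'⟩
      refine (continuousOn_const.mul (hgc.sub continuousOn_const) :
        ContinuousOn (fun v => (-1 : ℝ) * (g v - g c)) _).congr fun v hv => ?_
      rw [Real.sign_of_neg (by linarith [hv.2])]; rfl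

/-- Measurability and boundedness of `G₀` are both inherited from the sequence; in particular none
has to be assumed of the limit `u`. -/
theorem integrableOn_limit_mul {S : Set (ℝ × ℝ)} {G : ℕ → ℝ × ℝ → ℝ} {G₀ ψ : ℝ × ℝ → ℝ} {M : ℝ}
    (hG : ∀ m, Measurable (G m)) (hGM : ∀ m p, |G m p| ≤ M)
    (hGlim : ∀ᵐ p ∂(volume.restrict S), Tendsto (fun m => G m p) atTop (𝓝 (G₀ p)))
    (hψ : Continuous ψ) (hψc : HasCompactSupport ψ) :
    IntegrableOn (fun p => G₀ p * ψ p) S := by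
  refine (hψ.integrable_of_hasCompactSupport hψc).integrableOn.bdd_mul (c := M)
    (aestronglyMeasurable_of_tendsto_ae atTop (fun m => (hG m).aestronglyMeasurable) hGlim) ?_
  filter_upwards [hGlim] with p hp
  exact le_of_tendsto hp.norm (Eventually.of_forall fun m => hGM m p)

/-- The corrections are small enough for the regularization at scale `dx ^ β`. -/
theorem tendsto_corrector_rate {dx ε : ℕ → ℝ} {α β : ℝ} (hpos : ∀ m, 0 < dx m)
    (hdx : Tendsto dx atTop (𝓝 0)) (hβ : 0 < β) (hα : α = 2 / 3 + 2 * β)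
    (hε : ∀ᶠ m in atTop, ε m = dx m ^ β) (C K N : ℝ) :
    Tendsto (fun m => C * (K * dx m ^ α / dx m) *
      (2 / ε m * (dx m ^ (1 / 3 : ℝ) + dx m * N / (dx m ^ (1 / 3 : ℝ)) ^ 2) + dx m)) atTop
      (𝓝 0) := by
  have h1 : Tendsto (fun m => dx m ^ β) atTop (𝓝 0) := by
    have := hdx.rpow_const (p := β) (Or.inr hβ.le)
    rwa [Real.zero_rpow hβ.ne'] at this
  have h2 : Tendsto (fun m => dx m ^ α) atTop (𝓝 0) := by
    have hα0 : 0 < α := by linarith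
    have := hdx.rpow_const (p := α) (Or.inr hα0.le)
    rwa [Real.zero_rpow hα0.ne'] at this
  have h3 := ((h1.const_mul (2 * (1 + N))).add h2).const_mul (C * K)
  simp only [mul_zero, add_zero] at h3
  refine h3.congr' ?_
  filter_upwards [hε] with m hm
  have hx := hpos m
  rw [hm]
  generalize dx m = x at hx ⊢
  have hs : 0 < x ^ (1 / 3 : ℝ) := Real.rpow_pos_of_pos hx _
  have hb : 0 < x ^ β := Real.rpow_pos_of_pos hx _
  -- With `s = x ^ (1/3)` and `b = x ^ β` everything is a monomial: `x ^ α / x = b ^ 2 / s`, and the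
  -- whole expression becomes `C * K * (2 * (1 + N) * b + s ^ 2 * b ^ 2)`.
  have e1 : x ^ α = (x ^ (1 / 3 : ℝ)) ^ 2 * (x ^ β) ^ 2 := by
    rw [hα, Real.rpow_add hx, ← Real.rpow_natCast, ← Real.rpow_natCast, ← Real.rpow_mul hx.le,
      ← Real.rpow_mul hx.le]
    norm_num
    exact Or.inl (by rw [mul_comm])
  have e2 : x = (x ^ (1 / 3 : ℝ)) ^ 3 := by
    rw [← Real.rpow_natCast, ← Real.rpow_mul hx.le]
    norm_num
  rw [e1]
  generalize x ^ (1 / 3 : ℝ) = s at *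
  generalize x ^ β = b at *
  subst e2
  field_simp

/-- The cell averages of `k` vary at most as much as those of its variation function. -/
theorem abs_cellAverage_sub_le_variationFun {k : ℝ → ℝ} {D P : Finset ℝ} {kl ku : ℝ}
    (hbv : BoundedVariationOn k univ) (hk : ∀ᵐ x : ℝ, k x ∈ Icc kl ku)
    (hD : ∀ x, x ∈ D ↔ ¬ ContinuousAt k x) (hP : ContDiffOn ℝ 1 k ((P : Set ℝ)ᶜ)) {X : ℝ}
    (hX : 0 < X) {dx : ℝ} (hdx : 0 < dx) {i : ℤ} (h1 : -X ≤ ((i : ℝ) - 1) * dx / 2)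
    (h2 : ((i : ℝ) + 1) * dx / 2 + dx ≤ X) :
    |cellAverage k dx (i + 2) - cellAverage k dx i| ≤
      cellAverage (variationFun k D X) dx (i + 2) - cellAverage (variationFun k D X) dx i := by
  have hkm := measurable_of_bv hbv
  have hV := variationFun_mono D hbv hX
  have hqmp : Measure.QuasiMeasurePreserving (fun x : ℝ => x + dx) volume volume :=
    (measurePreserving_add_right volume dx).quasiMeasurePreserving
  have hDae : ∀ᵐ x : ℝ, x ∉ D := D.countable_toSet.ae_notMem volume
  refine abs_cellAverage_add_two_sub_le hdx
    (locallyIntegrable_of_ae_mem_Icc hkm.aestronglyMeasurable hk) hV.locallyIntegrable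
    (locallyIntegrable_of_ae_mem_Icc (hkm.comp (measurable_add_const dx)).aestronglyMeasurable
      (hqmp.ae hk))
    (hV.comp (monotone_id.add_const dx)).locallyIntegrable ?_
  -- Neither `x` nor `x + dx` may be a discontinuity; both exclusions are null sets.
  filter_upwards [hDae, hqmp.ae hDae] with x hx hx' hxi
  exact abs_sub_le_variationFun hbv hD hP hX (by linarith) hx hx' (h1.trans hxi.1)
    ((add_le_add_left hxi.2 dx).trans h2)

theorem abs_cellAverage_le {V : ℝ → ℝ} {M dx : ℝ} (hdx : 0 < dx)
    (hV : LocallyIntegrable V volume) (hM : ∀ x, |V x| ≤ M) (i : ℤ) :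
    |cellAverage V dx i| ≤ M :=
  abs_le.2 (cellAverage_mem_Icc hdx hV (Eventually.of_forall fun x => abs_le.1 (hM x)) i)

theorem ae_halfPlane_of_ae_fst {Q : ℝ → Prop} (h : ∀ᵐ x : ℝ, Q x) :
    ∀ᵐ p : ℝ × ℝ ∂(volume.restrict {p : ℝ × ℝ | 0 ≤ p.2}), Q p.1 := by
  rw [restrict_halfPlane_eq_prod]
  exact Measure.quasiMeasurePreserving_fst.ae h

/-- The flux composed with the coefficient has the expected derivative off a finite set. -/
theorem deriv_flux_comp {k : ℝ → ℝ} {P : Finset ℝ} {kl ku : ℝ}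
    (hbv : BoundedVariationOn k univ) (hk : ∀ᵐ x : ℝ, k x ∈ Icc kl ku)
    (hP : ContDiffOn ℝ 1 k ((P : Set ℝ)ᶜ)) {f : ℝ → ℝ → ℝ} {A B : ℝ → ℝ}
    (hf : ∀ κ ∈ Icc kl ku, ∀ v, f κ v = A v + κ * B v) (c : ℝ) {x : ℝ} (hx : x ∉ P) :
    deriv (fun x => f (k x) c) x = deriv k x * B c := by
  have hopen : IsOpen ((P : Set ℝ)ᶜ) := P.finite_toSet.isClosed.isOpen_compl
  have hd : ∀ z ∈ ((P : Set ℝ)ᶜ), DifferentiableAt ℝ k z := fun z hz =>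
    ((hP.differentiableOn (by norm_num)) z hz).differentiableAt (hopen.mem_nhds hz)
  have hev : (fun x => f (k x) c) =ᶠ[𝓝 x] fun x => A c + k x * B c := by
    filter_upwards [hopen.mem_nhds hx] with z hz
    refine hf _ ?_ c
    -- At a point of continuity the value is a one-sided limit, hence in `[kl, ku]` at every point
    -- off `P` and not merely almost everywhere.
    rw [← (hd z hz).continuousAt.continuousWithinAt.leftLim_eq]
    exact leftLim_mem_of_ae isClosed_Icc hk hbv z
  rw [hev.deriv_eq]
  exact (((hd x hx).hasDerivAt.mul_const (B c)).const_add (A c)).deriv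

/-! ### Passage to the limit in the scheme -/

/-- The limit of the weak entropy inequalities of the scheme, with the variation of the
coefficient expressed through its variation function. -/
theorem entropy_inequality_of_scheme {ul uu : ℝ} {u0 : ℝ → ℝ}
    (hu0_meas : AEStronglyMeasurable u0 volume) (hu0 : ∀ᵐ x : ℝ, u0 x ∈ Icc ul uu)
    {kl ku : ℝ} {k : ℝ → ℝ} {D P : Finset ℝ} (hbv : BoundedVariationOn k univ)
    (hk : ∀ᵐ x : ℝ, k x ∈ Icc kl ku) (hD : ∀ x : ℝ, x ∈ D ↔ ¬ ContinuousAt k x)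
    (hP : ContDiffOn ℝ 1 k ((P : Set ℝ)ᶜ)) {f : ℝ → ℝ → ℝ} {lam : ℝ} (hlam : 0 < lam)
    (hLip : ∀ κ ∈ Icc kl ku, ∀ v ∈ Icc ul uu, ∀ w ∈ Icc ul uu,
      lam * |f κ v - f κ w| ≤ 1 / 2 * |v - w|) {A B : ℝ → ℝ} {C₀ : ℝ}
    (hf : ∀ κ ∈ Icc kl ku, ∀ v, f κ v = A v + κ * B v)
    (hAB : ∀ v ∈ Icc ul uu, ∀ w ∈ Icc ul uu, |A v - A w| ≤ C₀ * |v - w| ∧ |B v - B w| ≤ C₀ * |v - w|)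
    {dx : ℕ → ℝ} (hdx_pos : ∀ m, 0 < dx m) (hdx : Tendsto dx atTop (𝓝 0))
    {U a : ℕ → ℕ → ℤ → ℝ}
    (hscheme : ∀ m, IsPredictorCorrector f k u0 lam (dx m) (U m) (a m)) {K α : ℝ} (hα : 2 / 3 < α)
    (ha : ∀ (m n : ℕ) (i : ℤ), Even (i + (n : ℤ)) → |a m (n + 1) i| ≤ K * dx m ^ α)
    (hbound : ∀ (m n : ℕ) (i : ℤ), Even (i + (n : ℤ)) → U m n i ∈ Icc ul uu)
    (hcubic : ∀ X T : ℝ, 0 < X → 0 < T →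
      ∃ C : ℝ, ∀ m, cubicSum (dx m) (lam * dx m) (U m) X T ≤ C)
    {u : ℝ → ℝ → ℝ}
    (hconv : ∀ᵐ p : ℝ × ℝ ∂(volume.restrict {p : ℝ × ℝ | 0 ≤ p.2}),
      Tendsto (fun m => gridFun (dx m) (lam * dx m) (U m) p) atTop (𝓝 (u p.1 p.2)))
    (c : ℝ) {φ : ℝ × ℝ → ℝ} (hφ : ContDiff ℝ ∞ φ) (hφc : HasCompactSupport φ)
    (hφ0 : ∀ p : ℝ × ℝ, 0 ≤ p.2 → 0 ≤ φ p) :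
    ∃ X : ℝ, 0 < X ∧ (∀ p, φ p ≠ 0 → |p.1| < X) ∧
      0 ≤ (∫ p in {p : ℝ × ℝ | 0 ≤ p.2},
          (|u p.1 p.2 - c| * deriv (fun t => φ (p.1, t)) p.2 +
            Real.sign (u p.1 p.2 - c) * (f (k p.1) (u p.1 p.2) - f (k p.1) c) *
              deriv (fun x => φ (x, p.2)) p.1)) +
        (∫ x, |u0 x - c| * φ (x, 0)) -
        |B c| * ∫ p in {p : ℝ × ℝ | 0 ≤ p.2},
          variationFun k D X p.1 * deriv (fun x => φ (x, p.2)) p.1 := by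
  obtain ⟨L, R, hL, hR, -, -, hsuppR, hsupp, hquot⟩ := exists_testFunction_bounds hφ hφc hlam
  obtain ⟨Cc, R', hCc, hR', hcorr⟩ := exists_corrector_bound hφ hφc hlam
  obtain ⟨N, hN⟩ := hcubic (R' + 1) (R' + lam) (by linarith) (by linarith)
  -- For `dx ≤ 1` the cells of a stencil that meets the support of `φ` stay within `R + 3` of the
  -- origin.
  have hX : 0 < R + 3 := by linarith
  refine ⟨R + 3, hX, fun p hp => ((norm_fst_le p).trans (hsuppR p hp)).trans_lt (by linarith), ?_⟩
  set V := variationFun k D (R + 3) with hV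
  have hVm : Monotone V := variationFun_mono D hbv hX
  obtain ⟨MV, hMV⟩ := exists_variationFun_bound D hbv hX
  have hkm := measurable_of_bv hbv
  have hkl : LocallyIntegrable k volume :=
    locallyIntegrable_of_ae_mem_Icc hkm.aestronglyMeasurable hk
  have hkA : ∀ m i, cellAverage k (dx m) i ∈ Icc kl ku := fun m i =>
    cellAverage_mem_Icc (hdx_pos m) hkl hk i
  obtain ⟨C, ε₀, hC, hε₀, hreg⟩ := exists_regularized_entropy hlam hLip hf
    (fun v hv w hw => (hAB v hv w hw).2) c
  -- Half of the excess of `α` over `2 / 3` pays for the factor `1 / ε`; the other half makes the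
  -- corrections vanish. The minimum with `ε₀` below keeps `ε` admissible on coarse meshes.
  obtain ⟨β, hβ_def⟩ : ∃ β, β = (α - 2 / 3) / 2 := ⟨_, rfl⟩
  have hβ : 0 < β := by rw [hβ_def]; linarith
  obtain ⟨ε, hε_def⟩ : ∃ ε : ℕ → ℝ, ε = fun m => min (dx m ^ β) ε₀ := ⟨_, rfl⟩
  have hpow : Tendsto (fun m => dx m ^ β) atTop (𝓝 0) := by
    have := hdx.rpow_const (p := β) (Or.inr hβ.le)
    rwa [Real.zero_rpow hβ.ne'] at this
  have hε_pos : ∀ m, 0 < ε m := fun m => by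
    rw [hε_def]; exact lt_min (Real.rpow_pos_of_pos (hdx_pos m) _) hε₀
  have hε_le : ∀ m, ε m ≤ ε₀ := fun m => by rw [hε_def]; exact min_le_right _ _
  have hε_ev : ∀ᶠ m in atTop, ε m = dx m ^ β := by
    filter_upwards [hpow.eventually (gt_mem_nhds hε₀)] with m hm
    rw [hε_def]; exact min_eq_left (le_of_lt hm)
  have hε_lim : Tendsto ε atTop (𝓝 0) := hpow.congr' (hε_ev.mono fun m hm => hm.symm)
  have hCε : Tendsto (fun m => C * ε m) atTop (𝓝 0) := by simpa using hε_lim.const_mul C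
  choose Ψ p Q r hr hΨ hQ hrB hp1 hpl hstep using fun m => hreg (ε m) (hε_pos m) (hε_le m)
  have hpm : ∀ m, Measurable (p m) := fun m =>
    (continuousOn_univ.1 (continuousOn_of_abs_sub_le
      fun v _ w _ => hpl m v w)).measurable
  set ug : ℕ → ℝ × ℝ → ℝ := fun m => gridFun (dx m) (lam * dx m) (U m) with hug
  set kg : ℕ → ℝ × ℝ → ℝ := fun m =>
    gridFun (dx m) (lam * dx m) (fun _ i => cellAverage k (dx m) i) with hkg
  set Vg : ℕ → ℝ × ℝ → ℝ := fun m =>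
    gridFun (dx m) (lam * dx m) (fun _ i => cellAverage V (dx m) i) with hVg
  set η : ℕ → ℝ × ℝ → ℝ := fun m => gridFun (dx m) (lam * dx m) (fun n i => Ψ m (U m n i)) with hη
  -- The source `r * |κ₂ - κ₁|` is at most `r` times the increment of the averages of `V`, so it is
  -- carried as part of the flux.
  set q : ℕ → ℝ × ℝ → ℝ := fun m => gridFun (dx m) (lam * dx m)
    (fun n i => Q m (cellAverage k (dx m) i) (U m n i) - r m * cellAverage V (dx m) i) with hq
  -- The corrections of step `n + 1` sit at indices with the parity of `n`, hence are stored at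
  -- level `n`.
  set ag : ℕ → ℝ × ℝ → ℝ := fun m =>
    gridFun (dx m) (lam * dx m) (fun n i => a m (n + 1) i) with hag
  have hugI : ∀ m s, ug m s ∈ Icc ul uu := fun m s => gridFun_forall (hbound m) s
  have hkgI : ∀ m s, kg m s ∈ Icc kl ku := fun m s => gridFun_forall (fun _ i _ => hkA m i) s
  have hVgI : ∀ m s, |Vg m s| ≤ MV := fun m s =>
    gridFun_forall (S := {y | |y| ≤ MV})
      (fun _ i _ => abs_cellAverage_le (hdx_pos m) hVm.locallyIntegrable hMV i) s
  have hagI : ∀ m s, |ag m s| ≤ K * dx m ^ α := fun m s =>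
    gridFun_forall (S := {y | |y| ≤ K * dx m ^ α}) (fun n i h => ha m n i h) s
  have hFcA := continuousOn_sign_mul_sub (fun v hv w hw => (hAB v hv w hw).1) c
  have hFcB := continuousOn_sign_mul_sub (fun v hv w hw => (hAB v hv w hw).2) c
  have hFsplit : ∀ κ ∈ Icc kl ku, ∀ v, Real.sign (v - c) * (f κ v - f κ c) =
      Real.sign (v - c) * (A v - A c) + κ * (Real.sign (v - c) * (B v - B c)) :=
    fun κ hκ v => by rw [hf κ hκ, hf κ hκ]; ring
  obtain ⟨bA, hbA⟩ := isCompact_Icc.exists_bound_of_continuousOn hFcA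
  obtain ⟨bB, hbB⟩ := isCompact_Icc.exists_bound_of_continuousOn hFcB
  have hΨM : ∀ m, ∀ v ∈ Icc ul uu, |Ψ m v| ≤ |ul| + |uu| + |c| + C * ε₀ := fun m v hv => by
    have h1 := hΨ m v hv
    have h2 := mul_le_mul_of_nonneg_left (hε_le m) hC
    have h3 : |v| ≤ |ul| + |uu| :=
      (abs_le_max_abs_abs hv.1 hv.2).trans (max_le_add_of_nonneg (abs_nonneg _) (abs_nonneg _))
    have h4 := abs_sub v c
    have h5 := abs_sub_abs_le_abs_sub (Ψ m v) |v - c|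
    rw [abs_abs] at h5
    linarith
  have hrM : ∀ m, r m ≤ |B c| + C * ε₀ := fun m => by
    have h1 := (le_abs_self _).trans (hrB m)
    have h2 := mul_le_mul_of_nonneg_left (hε_le m) hC
    linarith
  have hQM : ∀ m, ∀ κ ∈ Icc kl ku, ∀ v ∈ Icc ul uu,
      |Q m κ v| ≤ bA + (|kl| + |ku|) * bB + C * ε₀ := fun m κ hκ v hv => by
    have h1 := hQ m κ hκ v hv
    have h2 := mul_le_mul_of_nonneg_left (hε_le m) hC
    rw [hFsplit κ hκ v] at h1
    have h3 : |κ| ≤ |kl| + |ku| :=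
      (abs_le_max_abs_abs hκ.1 hκ.2).trans (max_le_add_of_nonneg (abs_nonneg _) (abs_nonneg _))
    have h4 := hbA v hv
    have h5 := mul_le_mul h3 (hbB v hv) (norm_nonneg _) (by positivity)
    rw [Real.norm_eq_abs] at h4 h5
    rw [← abs_mul] at h5
    have h6 := abs_add_le (Real.sign (v - c) * (A v - A c))
      (κ * (Real.sign (v - c) * (B v - B c)))
    have h7 := abs_sub_abs_le_abs_sub (Q m κ v) (Real.sign (v - c) * (A v - A c) +
      κ * (Real.sign (v - c) * (B v - B c)))
    linarith
  set M₁ := |ul| + |uu| + |c| + C * ε₀ with hM₁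
  set M₂ := bA + (|kl| + |ku|) * bB + C * ε₀ + (|B c| + C * ε₀) * MV with hM₂
  have hηM : ∀ m s, |η m s| ≤ M₁ := fun m s => hΨM m _ (hugI m s)
  have hqM : ∀ m s, |q m s| ≤ M₂ := fun m s => by
    have h1 := hQM m _ (hkgI m s) _ (hugI m s)
    have h2 := mul_le_mul (hrM m) (hVgI m s) (abs_nonneg _) ((hr m).trans (hrM m))
    have h3 : |r m * Vg m s| = r m * |Vg m s| := by rw [abs_mul, abs_of_nonneg (hr m)]
    have h4 : q m s = Q m (kg m s) (ug m s) - r m * Vg m s := rfl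
    rw [h4]
    have := abs_sub (Q m (kg m s) (ug m s)) (r m * Vg m s)
    linarith
  -- a.e. convergence
  set S : Set (ℝ × ℝ) := {p | 0 ≤ p.2} with hS
  have hk_lim : ∀ᵐ s ∂(volume.restrict S), Tendsto (fun m => kg m s) atTop (𝓝 (k s.1)) := by
    filter_upwards [ae_halfPlane_of_ae_fst (ae_tendsto_cellAverage hkl hdx_pos hdx)] with s hs
    exact hs _
  have hV_lim : ∀ᵐ s ∂(volume.restrict S), Tendsto (fun m => Vg m s) atTop (𝓝 (V s.1)) := by
    filter_upwards [ae_halfPlane_of_ae_fst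
      (ae_tendsto_cellAverage hVm.locallyIntegrable hdx_pos hdx)] with s hs
    exact hs _
  have hη_lim : ∀ᵐ s ∂(volume.restrict S),
      Tendsto (fun m => η m s) atTop (𝓝 |u s.1 s.2 - c|) := by
    filter_upwards [hconv] with s hs
    have h1 : Tendsto (fun m => |ug m s - c|) atTop (𝓝 |u s.1 s.2 - c|) :=
      (hs.sub_const c).abs
    have h2 : Tendsto (fun m => η m s - |ug m s - c|) atTop (𝓝 0) :=
      squeeze_zero_norm (fun m => hΨ m _ (hugI m s)) hCε
    simpa using h2.add h1
  have hr_lim : Tendsto r atTop (𝓝 |B c|) := by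
    have h2 : Tendsto (fun m => r m - |B c|) atTop (𝓝 0) := squeeze_zero_norm hrB hCε
    simpa using h2.add_const |B c|
  have hq_lim : ∀ᵐ s ∂(volume.restrict S), Tendsto (fun m => q m s) atTop
      (𝓝 (Real.sign (u s.1 s.2 - c) * (f (k s.1) (u s.1 s.2) - f (k s.1) c) -
        |B c| * V s.1)) := by
    filter_upwards [hconv, hk_lim, hV_lim, ae_halfPlane_of_ae_fst hk] with s hs hks hVs hkI
    have huI : u s.1 s.2 ∈ Icc ul uu :=
      isClosed_Icc.mem_of_tendsto hs (Eventually.of_forall fun m => hugI m s)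
    have hw : Tendsto (fun m => ug m s) atTop (𝓝[Icc ul uu] (u s.1 s.2)) :=
      tendsto_nhdsWithin_iff.2 ⟨hs, Eventually.of_forall fun m => hugI m s⟩
    have h1 := ((hFcA _ huI).tendsto.comp hw).add (hks.mul ((hFcB _ huI).tendsto.comp hw))
    rw [← hFsplit _ hkI] at h1
    have h2 : Tendsto (fun m => Q m (kg m s) (ug m s) -
        Real.sign (ug m s - c) * (f (kg m s) (ug m s) - f (kg m s) c)) atTop (𝓝 0) :=
      squeeze_zero_norm (fun m => hQ m _ (hkgI m s) _ (hugI m s)) hCε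
    have h3 := (h2.add h1).sub (hr_lim.mul hVs)
    rw [zero_add] at h3
    refine h3.congr fun m => ?_
    have h4 : q m s = Q m (kg m s) (ug m s) - r m * Vg m s := rfl
    rw [h4, hFsplit _ (hkgI m s)]
    simp only [Function.comp]
    ring
  -- the weak inequality on each mesh
  have hdx1 : ∀ᶠ m in atTop, dx m ≤ 1 :=
    (hdx.eventually (gt_mem_nhds one_pos)).mono fun m hm => le_of_lt hm
  have hweak : ∀ᶠ m in atTop, 0 ≤
      (∫ s in S, η m s * timeQuotient (dx m) (lam * dx m) φ s) +
      (1 / (lam * dx m)) * (∫ s in {s : ℝ × ℝ | 0 ≤ s.2 ∧ s.2 < lam * dx m}, η m s * φ s) +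
      (∫ s in S, q m s * spaceQuotient (dx m) (lam * dx m) φ s) +
      Cc * (K * dx m ^ α / dx m) * (2 / ε m * (dx m ^ (1 / 3 : ℝ) +
        dx m * N / (dx m ^ (1 / 3 : ℝ)) ^ 2) + dx m) := by
    filter_upwards [hdx1] with m hm1
    have hd := hdx_pos m
    have hdt : 0 < lam * dx m := mul_pos hlam hd
    have hA0 : 0 ≤ K * dx m ^ α := (abs_nonneg _).trans (hagI m 0)
    set e : ℝ × ℝ → ℝ := fun s => p m (ug m (s + (0, lam * dx m))) *
      (ag m (s + (-(dx m / 2), 0)) - ag m (s + (dx m / 2, 0))) with he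
    have hem : Measurable e :=
      ((hpm m).comp ((measurable_gridFun _ _ _).comp (measurable_add_const _))).mul
        (((measurable_gridFun _ _ _).comp (measurable_add_const _)).sub
          ((measurable_gridFun _ _ _).comp (measurable_add_const _)))
    have heM : ∀ s, |e s| ≤ K * dx m ^ α + K * dx m ^ α := fun s => by
      rw [he]
      dsimp only
      rw [abs_mul]
      have h1 := (abs_sub (ag m (s + (-(dx m / 2), 0))) (ag m (s + (dx m / 2, 0)))).trans
        (add_le_add (hagI m _) (hagI m _))
      have h2 := mul_le_mul (hp1 m (ug m (s + (0, lam * dx m)))) h1 (abs_nonneg _) zero_le_one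
      linarith
    have hM₁0 : 0 ≤ M₁ := (abs_nonneg _).trans (hηM m 0)
    have hM₂0 : 0 ≤ M₂ := (abs_nonneg _).trans (hqM m 0)
    have hmain := weak_inequality_of_step hd hlam (η := η m) (q := q m) (e := e) (φ := φ)
      (M := M₁ + M₂ + (K * dx m ^ α + K * dx m ^ α))
      (measurable_gridFun _ _ _) (measurable_gridFun _ _ _) hem
      (fun s => (hηM m s).trans (by linarith)) (fun s => (hqM m s).trans (by linarith))
      (fun s => (heM s).trans (by linarith)) hφ.continuous hφc hφ0 (by
        intro s hs hφs
        have hsR : |s.1| ≤ R := (norm_fst_le s).trans (hsupp (dx m) hd hm1 s (0, lam * dx m) (by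
          rw [Prod.norm_def]
          simp only [norm_zero, Real.norm_eq_abs, abs_of_pos hdt]
          refine max_le ?_ ?_ <;> nlinarith) hφs)
        obtain ⟨hs1, hs2⟩ := abs_le.1 hsR
        obtain ⟨n, i, hpar, hi1, hi2, hgrid⟩ := gridFun_stencil hd hdt hs
        have hupd := (hscheme m).2 n i hpar
        rw [laxFriedrichsStep] at hupd
        have hpar2 : Even (i + 2 + (n : ℤ)) := by
          rw [show i + 2 + (n : ℤ) = i + n + 2 by ring]
          exact hpar.add even_two
        have hpar1 : Even (i + 1 + ((n + 1 : ℕ) : ℤ)) := by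
          rw [show i + 1 + ((n + 1 : ℕ) : ℤ) = i + n + 2 by push_cast; ring]
          exact hpar.add even_two
        have hst := hstep m _ (hkA m i) _ (hkA m (i + 2)) _ (hbound m n i hpar) _
          (hbound m n (i + 2) hpar2) _ (hbound m (n + 1) (i + 1) hpar1) _ _ hupd
        -- The position of `q` relative to cell `i` keeps both cells inside `[-X, X]`, where `V`
        -- dominates the increments of `k`.
        have hkV := abs_cellAverage_sub_le_variationFun hbv hk hD hP hX hd (i := i)
          (by linarith) (by linarith)
        have hrV := mul_le_mul_of_nonneg_left
          (mul_le_mul_of_nonneg_left hkV (hr m)) hlam.le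
        simp only [hη, hq, he, hug, hag]
        rw [(hgrid _).1, (hgrid _).1, (hgrid _).1, (hgrid _).2.1, (hgrid _).2.1, (hgrid _).2.1,
          (hgrid _).2.2, (hgrid _).2.2]
        rw [← hV] at hrV
        linarith)
    have hE := hcorr (dx m) hd hm1 (U m) (fun n i => a m (n + 1) i) (p m) (K * dx m ^ α)
      (2 / ε m) N (|ul| + |uu|) (dx m ^ (1 / 3 : ℝ)) (Real.rpow_pos_of_pos hd _)
      (div_nonneg zero_le_two (hε_pos m).le) (hpm m) (hp1 m) (hpl m)
      (fun s => (abs_le_max_abs_abs (hugI m s).1 (hugI m s).2).trans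
        (max_le_add_of_nonneg (abs_nonneg _) (abs_nonneg _))) (hagI m) (hN m)
    exact hmain.trans (add_le_add_right hE _)
  -- passage to the limit
  have hT1 := tendsto_setIntegral_mul (S := S) (G := η)
    (T := fun m => timeQuotient (dx m) (lam * dx m) φ) (R := R) (L := L)
    (fun m => measurable_gridFun _ _ _) (fun m => by
      have := hφ.continuous
      unfold timeQuotient
      exact Continuous.measurable (by fun_prop)) hηM
    (hdx1.mono fun m hm s => (hquot (dx m) (hdx_pos m) hm s).1) hη_lim
    (tendsto_timeQuotient hφ hlam hdx_pos hdx)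
  have hT3 := tendsto_setIntegral_mul (S := S) (G := q)
    (T := fun m => spaceQuotient (dx m) (lam * dx m) φ) (R := R) (L := L)
    (fun m => measurable_gridFun _ _ _) (fun m => by
      have := hφ.continuous
      unfold spaceQuotient
      exact Continuous.measurable (by fun_prop)) hqM
    (hdx1.mono fun m hm s => (hquot (dx m) (hdx_pos m) hm s).2) hq_lim
    (tendsto_spaceQuotient hφ hdx_pos hdx)
  have hT2 := tendsto_initialLayer hφ hφc (dt := fun m => lam * dx m)
    (fun m => mul_pos hlam (hdx_pos m)) (by simpa using hdx.const_mul lam) (G := η)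
    (g := fun m x => η m (x, 0)) (g₀ := fun x => |u0 x - c|) (M := M₁)
    (fun m => (measurable_gridFun _ _ _).comp (measurable_id.prodMk measurable_const))
    (fun m x => hηM m _) (fun m s h0 h1 => by
      -- Throughout the first layer the level is `0`, so the grid function equals its trace at `t =
      -- 0`.
      have e1 : ⌊s.2 / (lam * dx m)⌋₊ = 0 := by
        rw [Nat.floor_eq_zero, div_lt_one (mul_pos hlam (hdx_pos m))]
        exact h1
      simp only [hη, gridFun]
      rw [e1, zero_div, Nat.floor_zero]) (by
      filter_upwards [ae_tendsto_cellAverage (locallyIntegrable_of_ae_mem_Icc hu0_meas hu0)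
        hdx_pos hdx] with x hx
      have hval : ∀ m, ug m (x, 0) = cellAverage u0 (dx m) (gridIndex (dx m) 0 x) := fun m => by
        simp only [hug, gridFun]
        rw [zero_div, Nat.floor_zero]
        refine (hscheme m).1 _ ?_
        simpa using even_gridIndex_add (dx m) 0 x
      have h1 : Tendsto (fun m => |ug m (x, 0) - c|) atTop (𝓝 |u0 x - c|) := by
        simp_rw [hval]
        exact ((hx fun _ => 0).sub_const c).abs
      have h2 : Tendsto (fun m => η m (x, 0) - |ug m (x, 0) - c|) atTop (𝓝 0) :=
        squeeze_zero_norm (fun m => hΨ m _ (hugI m _)) hCε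
      simpa using h2.add h1)
  have hT4 := tendsto_corrector_rate hdx_pos hdx hβ (α := α) (by rw [hβ_def]; ring) hε_ev Cc K N
  have hlim := ge_of_tendsto (((hT1.add hT2).add hT3).add hT4) hweak
  -- rearrangement of the limit
  have hdc : ∀ v : ℝ × ℝ, Continuous fun s : ℝ × ℝ => fderiv ℝ φ s v := fun v =>
    (hφ.continuous_fderiv (by simp)).clm_apply continuous_const
  have hdcs : ∀ v : ℝ × ℝ, HasCompactSupport fun s : ℝ × ℝ => fderiv ℝ φ s v := fun v =>
    hφc.fderiv_apply ℝ v
  have I1 := integrableOn_limit_mul (S := S) (fun m => measurable_gridFun _ _ _) hηM hη_lim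
    (hdc (0, 1)) (hdcs (0, 1))
  have I2 := integrableOn_limit_mul (S := S) (fun m => measurable_gridFun _ _ _) hqM hq_lim
    (hdc (1, 0)) (hdcs (1, 0))
  have I3 := integrableOn_limit_mul (S := S) (fun m => measurable_gridFun _ _ _) hVgI hV_lim
    (hdc (1, 0)) (hdcs (1, 0))
  simp_rw [← deriv_snd_eq_fderiv hφ] at I1
  simp_rw [← deriv_fst_eq_fderiv hφ] at I2 I3
  -- The part `|B c| * V` of the limiting flux is split off; integrability of each piece comes from
  -- its approximations.
  have e : (∫ s in S, (|u s.1 s.2 - c| * deriv (fun t => φ (s.1, t)) s.2 +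
      Real.sign (u s.1 s.2 - c) * (f (k s.1) (u s.1 s.2) - f (k s.1) c) *
        deriv (fun x => φ (x, s.2)) s.1)) =
      (∫ s in S, |u s.1 s.2 - c| * deriv (fun t => φ (s.1, t)) s.2) +
      (∫ s in S, (Real.sign (u s.1 s.2 - c) * (f (k s.1) (u s.1 s.2) - f (k s.1) c) -
        |B c| * V s.1) * deriv (fun x => φ (x, s.2)) s.1) +
      |B c| * ∫ s in S, V s.1 * deriv (fun x => φ (x, s.2)) s.1 := by
    have I12 : IntegrableOn (fun s => |u s.1 s.2 - c| * deriv (fun t => φ (s.1, t)) s.2 +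
      (Real.sign (u s.1 s.2 - c) * (f (k s.1) (u s.1 s.2) - f (k s.1) c) -
        |B c| * V s.1) * deriv (fun x => φ (x, s.2)) s.1) S := I1.add I2
    rw [← integral_const_mul, ← integral_add I1 I2, ← integral_add I12 (I3.const_mul _)]
    refine integral_congr_ae (Eventually.of_forall fun s => ?_)
    dsimp only
    ring
  rw [e]
  linarith

/-! ### The entropy inequality -/

theorem mainTheorem3
    -- initial datum in L∞
    (ul uu : ℝ) (u0 : ℝ → ℝ) (hu0_meas : AEStronglyMeasurable u0 volume)
    (hu0 : ∀ᵐ x : ℝ, u0 x ∈ Set.Icc ul uu)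
    -- coefficient: bounded variation, piecewise C¹, finitely many discontinuities
    (kl ku : ℝ) (k : ℝ → ℝ) (D : Finset ℝ)
    (hk_bv : BoundedVariationOn k Set.univ)
    (hk : ∀ᵐ x : ℝ, k x ∈ Set.Icc kl ku)
    (hD : ∀ x : ℝ, x ∈ D ↔ ¬ ContinuousAt k x)
    (hk_C1 : ∃ P : Finset ℝ, ContDiffOn ℝ 1 k ((P : Set ℝ)ᶜ))
    -- flux: C³ in the state; C² in the coefficient with vanishing second derivative
    (f : ℝ → ℝ → ℝ)
    (hf_u : ∀ κ ∈ Set.Icc kl ku, ContDiffOn ℝ 3 (f κ) (Set.Icc ul uu))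
    (hf_k : ∀ v : ℝ, ContDiffOn ℝ 2 (fun κ => f κ v) (Set.Icc kl ku))
    (hf_kk : ∀ v : ℝ, ∀ κ ∈ Set.Icc kl ku,
      iteratedDerivWithin 2 (fun κ' => f κ' v) (Set.Icc kl ku) κ = 0)
    -- fixed mesh ratio, with the CFL condition of the Lax–Friedrichs step
    (lam : ℝ) (hlam : 0 < lam)
    (hCFL : ∀ κ ∈ Set.Icc kl ku, ∀ v ∈ Set.Icc ul uu,
      lam * |derivWithin (f κ) (Set.Icc ul uu) v| ≤ 1 / 2)
    -- mesh sizes tending to zero, and the scheme on each mesh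
    (dx : ℕ → ℝ) (hdx_pos : ∀ m, 0 < dx m) (hdx : Filter.Tendsto dx Filter.atTop (nhds 0))
    (U a : ℕ → ℕ → ℤ → ℝ)
    (hscheme : ∀ m, IsPredictorCorrector f k u0 lam (dx m) (U m) (a m))
    -- size of the corrections
    (K α : ℝ) (hα : 2 / 3 < α)
    (ha : ∀ (m n : ℕ) (i : ℤ), Even (i + (n : ℤ)) → |a m (n + 1) i| ≤ K * dx m ^ α)
    -- uniform bound, local cubic estimate, convergence almost everywhere
    (hbound : ∀ (m n : ℕ) (i : ℤ), Even (i + (n : ℤ)) → U m n i ∈ Set.Icc ul uu)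
    (hcubic : ∀ X T : ℝ, 0 < X → 0 < T →
      ∃ C : ℝ, ∀ m, cubicSum (dx m) (lam * dx m) (U m) X T ≤ C)
    (u : ℝ → ℝ → ℝ)
    (hconv : ∀ᵐ p : ℝ × ℝ ∂(MeasureTheory.volume.restrict {p : ℝ × ℝ | 0 ≤ p.2}),
      Filter.Tendsto (fun m => approxSolution (dx m) (lam * dx m) (U m) p.1 p.2)
        Filter.atTop (nhds (u p.1 p.2))) :
    IsEntropySolution f k D u0 u := by
  simp_rw [approxSolution_eq_gridFun] at hconv
  obtain ⟨P, hP⟩ := hk_C1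
  have hkk : kl ≤ ku := by
    obtain ⟨z, -, hz⟩ := exists_mem_Ioo_of_ae hk zero_lt_one
    exact hz.1.trans hz.2
  have hLip : ∀ κ ∈ Icc kl ku, ∀ v ∈ Icc ul uu, ∀ w ∈ Icc ul uu,
      lam * |f κ v - f κ w| ≤ 1 / 2 * |v - w| := fun κ hκ v hv w hw => by
    -- The mean value inequality turns the CFL condition into a Lipschitz bound, the only form in
    -- which it is used.
    have h1 := (convex_Icc ul uu).norm_image_sub_le_of_norm_derivWithin_le (C := 1 / 2 / lam)
      ((hf_u κ hκ).differentiableOn (by norm_num)) (fun x hx => by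
        rw [le_div_iff₀ hlam, Real.norm_eq_abs, mul_comm]
        exact hCFL κ hκ x hx) hw hv
    rw [Real.norm_eq_abs, Real.norm_eq_abs, div_mul_eq_mul_div, le_div_iff₀ hlam] at h1
    linarith
  obtain ⟨A, B, C₀, hf, hAB⟩ := exists_affine_flux hlam hkk hf_k hf_kk hLip
  refine ⟨?_, fun c φ hφ hφc hφ0 => ?_⟩
  · refine memLp_top_of_bound (C := |ul| + |uu|) (aestronglyMeasurable_of_tendsto_ae atTop
      (fun m => (measurable_gridFun (dx m) (lam * dx m) (U m)).aestronglyMeasurable) hconv) ?_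
    filter_upwards [hconv] with p hp
    refine le_of_tendsto hp.norm (Eventually.of_forall fun m => ?_)
    have h := gridFun_forall (dx := dx m) (dt := lam * dx m) (hbound m) p
    exact (abs_le_max_abs_abs h.1 h.2).trans
      (max_le_add_of_nonneg (abs_nonneg _) (abs_nonneg _))
  · obtain ⟨X, hX, hφX, hlim⟩ := entropy_inequality_of_scheme hu0_meas hu0 hk_bv hk hD hP hlam
      hLip hf hAB hdx_pos hdx hscheme hα ha hbound hcubic hconv c hφ hφc hφ0
    rw [setIntegral_variationFun_mul_deriv hk_bv hX hφ hφc hφX] at hlim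
    have h3 : (∫ p in {p : ℝ × ℝ | p.1 ∉ D ∧ 0 ≤ p.2},
        |deriv (fun x => f (k x) c) p.1| * φ p) =
        |B c| * ∫ p in {p : ℝ × ℝ | 0 ≤ p.2}, |deriv k p.1| * φ p := by
      -- Vertical lines over `D` are null, so removing them does not change the integral; the jumps
      -- enter only through the separate sum.
      have hset : ({p : ℝ × ℝ | p.1 ∉ D ∧ 0 ≤ p.2} : Set (ℝ × ℝ)) =ᵐ[volume]
          ({p : ℝ × ℝ | 0 ≤ p.2} : Set (ℝ × ℝ)) := by
        have : ∀ᵐ p : ℝ × ℝ, p.1 ∉ D := by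
          rw [Measure.volume_eq_prod]
          exact Measure.quasiMeasurePreserving_fst.ae (D.countable_toSet.ae_notMem volume)
        filter_upwards [this] with p hp
        exact propext ⟨fun h => h.2, fun h => ⟨hp, h⟩⟩
      rw [setIntegral_congr_set hset, ← integral_const_mul]
      refine integral_congr_ae ?_
      filter_upwards [ae_halfPlane_of_ae_fst (P.countable_toSet.ae_notMem volume)] with p hp
      rw [deriv_flux_comp hk_bv hk hP hf c hp, abs_mul]
      ring
    have h4 : ∑ y ∈ D, ∫ t in Ici (0 : ℝ),
        |f (Function.rightLim k y) c - f (Function.leftLim k y) c| * φ (y, t) =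
        |B c| * ∑ y ∈ D, ∫ t in Ici (0 : ℝ), |jumpAt k y| * φ (y, t) := by
      rw [Finset.mul_sum]
      refine Finset.sum_congr rfl fun y _ => ?_
      rw [← integral_const_mul]
      refine integral_congr_ae (Eventually.of_forall fun t => ?_)
      dsimp only
      rw [hf _ (rightLim_mem_of_ae isClosed_Icc hk hk_bv y),
        hf _ (leftLim_mem_of_ae isClosed_Icc hk hk_bv y), jumpAt, ← mul_assoc, ← abs_mul]
      congr 2
      ring
    rw [h3, h4]
    linarith
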